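/- Let $F$ be a field of characteristic different from $2$ which is either a finite field of characteristic $p$ (with the discrete topology) or a non-archimedean local field of residual characteristic $p$. Let $(W,\langle\ ,\ \rangle)$ be a finite-dimensional symplectic vector space over $F$ with its natural topology, and let $H=H(W)$ be the Heisenberg group: the set $W\times F$ with the product topology and the group law $(w,t)(w',t')=\left(w+w',\,t+t'+\tfrac12\langle w,w'\rangle\right)$, with $t\in F$ identified with the central element $(0,t)$. Let $R$ be a field and let $\psi:F\to R^\times$ be a non-trivial smooth (i.e. locally constant) character of the additive group of $F$. A representation of a topological group $G$ on an $R$-vector space is smooth if the stabiliser of every vector is open. If $K$ is a closed subgroup of $G$ and $\chi:K\to R^\times$ is a smooth character, the compact induction $\mathrm{ind}_K^G(\chi)$ is the space of functions $f:G\to R$ such that $f(kg)=\chi(k)f(g)$ for all $k\in K$, $g\in G$, such that $f$ is invariant under right translation by some open subgroup of $G$, and such that the support of $f$ is compact modulo $K$; the group $G$ acts on it by right translation. For a subgroup $A$ of $W$ put $A^\perp=\{w\in W : \psi(\langle w,a\rangle)=1 \text{ for all } a\in A\}$; it is a closed subgroup of $W$. Call $A$ self-dual if $A=A^\perp$, and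 let $A_H=A\times F\subseteq H$. Then: 1. The characteristic of $R$ is different from $p$. 2. Up to isomorphism there is exactly one irreducible smooth $R$-representation of $H$ with central character $\psi$, i.e. such that $(0,t)$ acts by the scalar $\psi(t)$ for every $t\in F$. 3. For every self-dual subgroup $A$ of $W$, the character $\psi$ extends to a smooth character of $A_H$ with values in $R^\times$, and for every such extension $\psi_A$ the representation $\mathrm{ind}_{A_H}^H(\psi_A)$ is smooth and irreducible with central character $\psi$, hence is a model of the representation in 2. 4. Lagrangians in $W$ (totally isotropic subspaces of dimension $\tfrac12\dim W$) exist, and every Lagrangian $X$ is a self-dual subgroup, for which $(x,t)\mapsto\psi(t)$ is a smooth character of $X_H$ extending $\psi$. If $F$ is a non-archimedean local field with ring of integers $\mathcal O_F$, there exist self-dual lattices in $W$, i.e. free $\mathcal O_F$-submodules of $W$ of rank $\dim W$ that are self-dual subgroups. So 3 applies to these. -/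

import Mathlib

open scoped ValuativeRel

universe uF uW uR v₁ v₂

/-- `F`, with its topology, is either a finite (discrete) field of characteristic `p`, or a
non-archimedean local field of residual characteristic `p`. -/
def IsFiniteOrLocalField (F : Type uF) [Field F] [TopologicalSpace F] (p : ℕ) : Prop :=
  (Finite F ∧ DiscreteTopology F ∧ CharP F p) ∨
    ∃ _ : ValuativeRel F, IsNonarchimedeanLocalField F ∧ CharP 𝓀[F] p

section Heisenberg

variable {F : Type uF} [Field F] {W : Type uW} [AddCommGroup W] [Module F W]

/-- The underlying set `W × F` of the Heisenberg group of `(W, B)`. -/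
@[ext]
structure Heisenberg (B : LinearMap.BilinForm F W) where
  vec : W
  scalar : F

namespace Heisenberg

variable {B : LinearMap.BilinForm F W}

/-- `(w, t) (w', t') = (w + w', t + t' + ⟨w, w'⟩ / 2)`. -/
instance : Mul (Heisenberg B) where
  mul g h := ⟨g.vec + h.vec, g.scalar + h.scalar + B g.vec h.vec / 2⟩

instance : One (Heisenberg B) where
  one := ⟨0, 0⟩

/-- For alternating `B` this is `(w, t)⁻¹ = (-w, -t)`. -/
instance : Inv (Heisenberg B) where
  inv g := ⟨-g.vec, -g.scalar + B g.vec g.vec / 2⟩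

@[simp] theorem mul_vec (g h : Heisenberg B) : (g * h).vec = g.vec + h.vec := rfl

@[simp] theorem mul_scalar (g h : Heisenberg B) :
    (g * h).scalar = g.scalar + h.scalar + B g.vec h.vec / 2 := rfl

@[simp] theorem one_vec : (1 : Heisenberg B).vec = 0 := rfl

@[simp] theorem one_scalar : (1 : Heisenberg B).scalar = 0 := rfl

@[simp] theorem inv_vec (g : Heisenberg B) : g⁻¹.vec = -g.vec := rfl

@[simp] theorem inv_scalar (g : Heisenberg B) :
    g⁻¹.scalar = -g.scalar + B g.vec g.vec / 2 := rfl

instance : Group (Heisenberg B) :=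
  Group.ofLeftAxioms
    (fun a b c => by
      ext
      · simp [add_assoc]
      · simp only [mul_scalar, mul_vec, map_add, LinearMap.add_apply]
        ring)
    (fun a => by ext <;> simp)
    (fun a => by
      ext
      · simp
      · simp only [mul_scalar, inv_vec, inv_scalar, map_neg, LinearMap.neg_apply, one_scalar]
        ring)

/-- The product topology on `W × F`. -/
instance [TopologicalSpace F] [TopologicalSpace W] : TopologicalSpace (Heisenberg B) :=
  TopologicalSpace.induced (fun g => (g.vec, g.scalar)) inferInstance

instance [TopologicalSpace F] [IsTopologicalRing F] [FiniteDimensional F W]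
    [TopologicalSpace W] [IsModuleTopology F W] : IsTopologicalGroup (Heisenberg B) := by
  have hadd : IsTopologicalAddGroup W := IsModuleTopology.topologicalAddGroup F W
  have hB : Continuous (fun x : W × W => B x.1 x.2) :=
    IsModuleTopology.continuous_bilinear_of_finite_left B
  have hp : Continuous (fun g : Heisenberg B => (g.vec, g.scalar)) := continuous_induced_dom
  have hv : Continuous (fun g : Heisenberg B => g.vec) := continuous_fst.comp hp
  have hs : Continuous (fun g : Heisenberg B => g.scalar) := continuous_snd.comp hp
  refine { continuous_mul := ?_, continuous_inv := ?_ }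
  · refine continuous_induced_rng.2 (Continuous.prodMk ?_ ?_)
    · exact (hv.comp continuous_fst).add (hv.comp continuous_snd)
    · refine ((hs.comp continuous_fst).add (hs.comp continuous_snd)).add ?_
      simp only [div_eq_mul_inv]
      exact (hB.comp ((hv.comp continuous_fst).prodMk (hv.comp continuous_snd))).mul
        continuous_const
  · refine continuous_induced_rng.2 (Continuous.prodMk ?_ ?_)
    · exact hv.neg
    · refine hs.neg.add ?_
      simp only [div_eq_mul_inv]
      exact (hB.comp (hv.prodMk hv)).mul continuous_const

/-- The subgroup `A × F` of the Heisenberg group, for a subgroup `A` of `W`. -/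
def preimage (B : LinearMap.BilinForm F W) (A : AddSubgroup W) : Subgroup (Heisenberg B) where
  carrier := {g | g.vec ∈ A}
  mul_mem' hg hh := A.add_mem hg hh
  one_mem' := A.zero_mem
  inv_mem' hg := A.neg_mem hg

/-- The element `(0, t)` of `A × F`. -/
def central (B : LinearMap.BilinForm F W) (A : AddSubgroup W) (t : F) : preimage B A :=
  ⟨⟨0, t⟩, A.zero_mem⟩

end Heisenberg

/-- `A^⊥ = {w ∈ W | ψ(⟨w, a⟩) = 1 for all a ∈ A}`. -/
def psiOrthogonal {R : Type uR} [Field R] (ψ : AddChar F Rˣ) (B : LinearMap.BilinForm F W)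
    (A : AddSubgroup W) : AddSubgroup W where
  carrier := {w | ∀ a ∈ A, ψ (B w a) = 1}
  add_mem' hx hy a ha := by simp [AddChar.map_add_eq_mul, hx a ha, hy a ha]
  zero_mem' a _ := by simp
  neg_mem' hx a ha := by simp [AddChar.map_neg_eq_inv, hx a ha]

/-- `A` is self-dual with respect to `ψ ∘ B`. This forces `A` to be closed in `W` when `ψ` is
smooth, because every `A^⊥` is closed. -/
def IsSelfDual {R : Type uR} [Field R] (ψ : AddChar F Rˣ) (B : LinearMap.BilinForm F W)
    (A : AddSubgroup W) : Prop :=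
  A = psiOrthogonal ψ B A

/-- A Lagrangian: a totally isotropic subspace of half the dimension. -/
def IsLagrangian (B : LinearMap.BilinForm F W) (X : Submodule F W) : Prop :=
  (∀ x ∈ X, ∀ y ∈ X, B x y = 0) ∧ 2 * Module.finrank F X = Module.finrank F W

/-- A lattice in `W`: a free `𝒪[F]`-submodule whose rank is the dimension of `W`. -/
def IsLatticeIn [ValuativeRel F] (L : Submodule 𝒪[F] W) : Prop :=
  Module.Free 𝒪[F] L ∧ Module.finrank 𝒪[F] L = Module.finrank F W

/-- `χ` is a smooth character of `A × F` whose restriction to `F` is `ψ`. -/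
def IsSmoothExtension {R : Type uR} [Field R] [TopologicalSpace F] [TopologicalSpace W]
    (ψ : AddChar F Rˣ) (B : LinearMap.BilinForm F W) (A : AddSubgroup W)
    (χ : Heisenberg.preimage B A →* Rˣ) : Prop :=
  IsLocallyConstant χ ∧ ∀ t : F, χ (Heisenberg.central B A t) = ψ t

end Heisenberg

/-- A representation is smooth if all stabilisers of vectors are open. -/
def IsSmoothRep {R : Type uR} [Field R] {G : Type*} [Group G] [TopologicalSpace G]
    {S : Type*} [AddCommGroup S] [Module R S] (ρ : Representation R G S) : Prop :=
  ∀ v : S, IsOpen {g : G | ρ g v = v}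

/-- `ρ` is an irreducible smooth representation of the Heisenberg group in which each central
element `(0, t)` acts by the scalar `ψ(t)`. -/
structure IsHeisenbergRep {F : Type uF} [Field F] [TopologicalSpace F]
    {W : Type uW} [AddCommGroup W] [Module F W] [TopologicalSpace W]
    (B : LinearMap.BilinForm F W) {R : Type uR} [Field R] (ψ : AddChar F Rˣ)
    {S : Type*} [AddCommGroup S] [Module R S] (ρ : Representation R (Heisenberg B) S) :
    Prop where
  smooth : IsSmoothRep ρ
  irreducible : ρ.IsIrreducible
  central : ∀ (t : F) (v : S), ρ ⟨0, t⟩ v = ((ψ t : Rˣ) : R) • v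

section CompactInduction

open scoped Pointwise

variable {R : Type uR} [Field R] {G : Type*} [Group G] [TopologicalSpace G]
  [IsTopologicalGroup G] {K : Subgroup G}

/-- The space of the compact induction of a character `χ` of the subgroup `K`: the functions
`f : G → R` with `f (k g) = χ(k) f(g)`, invariant under right translation by some open subgroup,
whose support is compact modulo `K`. -/
def compactInductionSpace (χ : K →* Rˣ) : Submodule R (G → R) where
  carrier := {f | (∀ (k : K) (g : G), f (k * g) = ((χ k : Rˣ) : R) * f g) ∧
    (∃ U : OpenSubgroup G, ∀ (g : G), ∀ u ∈ U, f (g * u) = f g) ∧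
    ∃ C : Set G, IsCompact C ∧ Function.support f ⊆ (K : Set G) * C}
  zero_mem' := ⟨by simp, ⟨⊤, by simp⟩, ∅, by simp⟩
  add_mem' := by
    rintro f f' ⟨h1, ⟨U, hU⟩, C, hC, hfC⟩ ⟨h1', ⟨U', hU'⟩, C', hC', hfC'⟩
    refine ⟨fun k g => ?_, ⟨U ⊓ U', fun g u hu => ?_⟩, C ∪ C', hC.union hC', ?_⟩
    · simp [h1, h1', mul_add]
    · have hu' : u ∈ U ∧ u ∈ U' := hu
      simp [hU g u hu'.1, hU' g u hu'.2]
    · refine (Function.support_add f f').trans ?_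
      rw [Set.mul_union]
      exact Set.union_subset_union hfC hfC'
  smul_mem' := by
    rintro c f ⟨h1, ⟨U, hU⟩, C, hC, hfC⟩
    refine ⟨fun k g => ?_, ⟨U, fun g u hu => ?_⟩, C, hC, ?_⟩
    · simp [h1, mul_left_comm]
    · simp [hU g u hu]
    · exact (Function.support_const_smul_subset c f).trans hfC

/-- Right translation on functions preserves the space of the compact induction. -/
theorem compactInductionSpace_translate (χ : K →* Rˣ) (x : G) {f : G → R}
    (hf : f ∈ compactInductionSpace χ) : (fun g => f (g * x)) ∈ compactInductionSpace χ := by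
  obtain ⟨h1, ⟨U, hU⟩, C, hC, hfC⟩ := hf
  refine ⟨fun k g => ?_, ⟨U.comap (MulAut.conj x⁻¹).toMonoidHom ?_, fun g u hu => ?_⟩,
    (fun c => c * x⁻¹) '' C, hC.image (continuous_mul_const x⁻¹), fun g hg => ?_⟩
  · simpa [mul_assoc] using h1 k (g * x)
  · change Continuous (fun u : G => x⁻¹ * u * x⁻¹⁻¹)
    fun_prop
  · have hu' : x⁻¹ * u * x ∈ U := by simpa using hu
    have h := hU (g * x) _ hu'
    simpa [mul_assoc] using h
  · have hg' : g * x ∈ Function.support f := hg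
    obtain ⟨k, hk, c, hc, hkc⟩ := Set.mem_mul.1 (hfC hg')
    exact Set.mem_mul.2 ⟨k, hk, c * x⁻¹, ⟨c, hc, rfl⟩, by rw [← mul_assoc, hkc]; simp⟩

/-- The compact induction of `χ` from `K` to `G`: `G` acts by right translation. -/
def compactInduction (χ : K →* Rˣ) : Representation R G (compactInductionSpace χ) where
  toFun x :=
    { toFun := fun f => ⟨fun g => f.1 (g * x), compactInductionSpace_translate χ x f.2⟩
      map_add' := fun _ _ => rfl
      map_smul' := fun _ _ => rfl }
  map_one' := by
    ext f
    simp
  map_mul' x y := by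
    ext f
    simp [mul_assoc]

end CompactInduction

/-!
# The Stone–von Neumann theorem over finite and local fields

The prime `p` is invertible in `R` because `ψ` takes values in `p`-power
roots of unity: `p ^ n x → 0` and `ψ` is locally constant, so `ψ(x) ^ (p ^ n) = 1` for large `n`,
and a field of characteristic `p` has no nontrivial such root (`exists_pow_psi_eq_one`,
`ringChar_ne_of_isTopologicallyNilpotent`).

Everything else is compared with one auxiliary compact open self-dual subgroup `Λ` of `W`
(`IsGoodLattice`): a Lagrangian if `F` is finite (`IsLagrangian.isGoodLattice`), and a lattice
built from a symplectic basis and the conductor of `ψ` if `F` is local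
(`exists_isSelfDual_lattice`). Fix an extension `χ` of `ψ` to `Λ × F`. In a smooth representation
`V` with central character `ψ`, Fourier inversion on finite quotients of `Λ` shows that `V` is the
sum of the eigenspaces of `Λ × F` for the conjugates of `χ` (`mem_span_conjEigenspace`). The group
permutes these eigenspaces transitively, so the eigenspace `V[χ]` generates `V`, and this applies to
every subrepresentation. Two consequences:

* if `V ≠ 0` and `dim V[χ] ≤ 1`, then `V` is irreducible (`isIrreducible_of_conjEigenspace_le`);
* a representation generated by one vector of `V[χ]` has `dim V[χ] ≤ 1`, because eigenvectors with
  distinct eigencharacters are independent (`mem_span_singleton_of_mem_conjEigenspace`). For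
  irreducible `V₁`, `V₂` this makes the subrepresentation of `V₁ × V₂` generated by a pair of
  eigenvectors the graph of an isomorphism (`nonempty_equiv`).

For a self-dual `A` and an extension `ψ_A` of `ψ`, an element of `V[χ]` in the compact induction of
`ψ_A` is a function on `H` transforming on both sides. If it is nonzero at `w` and at `w'`, then
`w - w'` is orthogonal to `A ∩ Λ`; and `(A ∩ Λ)^⊥ = A + Λ`, so that the function lives on a single
double coset and `dim V[χ] ≤ 1` (`exists_conjEigenspace_le_span`). The equality
`(A ∩ Λ)^⊥ = A + Λ` says that the open subgroup `A + Λ` is its own double orthogonal; it follows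
from duality for finite groups by compactness of `Λ` (`IsGoodLattice.psiOrthogonal_inf_le`).

Since `R` is an arbitrary field, `Rˣ` need not be divisible, and the existence of `ψ_A` uses `p`.
If `p ≠ 2`, then `(a, t) ↦ ψ(t)` is a character of `A × F`. If `p = 2`, then `F` has characteristic
zero, the image of `ψ` is divisible, and `ψ_A` is obtained from the injectivity of divisible groups
(`exists_extension_of_charZero`).
-/

open Heisenberg

/-! ### Pairings of finite abelian groups -/

section FinitePairing

variable {R : Type*} [Field R] {A D : Type*} [AddCommGroup A] [AddCommGroup D]

theorem sum_toMul_eq_zero [Fintype D] (φ : D →+ Additive Rˣ) (hφ : φ ≠ 0) :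
    ∑ d, ((φ d).toMul : R) = 0 := by
  obtain ⟨d₀, hd₀⟩ : ∃ d, φ d ≠ 0 := by
    by_contra! h
    exact hφ (AddMonoidHom.ext h)
  have h : ((φ d₀).toMul : R) * ∑ d, ((φ d).toMul : R) = ∑ d, ((φ d).toMul : R) := by
    rw [Finset.mul_sum]
    refine Fintype.sum_equiv (Equiv.addLeft d₀) _ _ fun d => ?_
    simp [map_add]
  have h1 : ((φ d₀).toMul : R) ≠ 1 := fun h1 => hd₀ (by
    apply Additive.toMul.injective
    exact Units.ext h1)
  have h2 : (((φ d₀).toMul : R) - 1) * ∑ d, ((φ d).toMul : R) = 0 := by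
    rw [sub_mul, h, one_mul, sub_self]
  exact (mul_eq_zero.1 h2).resolve_left (sub_ne_zero.2 h1)

/-- The pairing induced on the quotients by subgroups `L` and `E` contained in the kernels. -/
def quotientPairing (b : A →+ D →+ Additive Rˣ) (L : AddSubgroup A) (E : AddSubgroup D)
    (hL : ∀ a ∈ L, b a = 0) (hE : ∀ a, ∀ d ∈ E, b a d = 0) :
    A ⧸ L →+ D ⧸ E →+ Additive Rˣ :=
  QuotientAddGroup.lift L
    { toFun := fun a => QuotientAddGroup.lift E (b a) (hE a)
      map_zero' := by ext; simp
      map_add' := fun _ _ => by ext; simp; rfl }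
    (fun a ha => by ext d; simp [hL a ha])

/-- Fourier inversion: if the characters `b(·, d)` of `A` separate the points of the finite
quotient `A ⧸ L`, then every vector fixed by `L` is a sum of eigenvectors of `A` with
eigencharacters of the form `b(·, d)`. -/
theorem mem_span_eigenvectors {V : Type*} [AddCommGroup V] [Module R V]
    (b : A →+ D →+ Additive Rˣ) (L : AddSubgroup A) (E : AddSubgroup D) [L.FiniteIndex]
    [E.FiniteIndex] (hcard : (E.index : R) ≠ 0) (hL : ∀ a ∈ L, b a = 0)
    (hE : ∀ a, ∀ d ∈ E, b a d = 0) (hsep : ∀ a, b a = 0 → a ∈ L)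
    (π : A → V →ₗ[R] V) (hπ : ∀ a a' v, π (a + a') v = π a (π a' v))
    (v : V) (hv : ∀ a ∈ L, π a v = v) :
    v ∈ Submodule.span R {u | ∃ d, ∀ a, π a u = ((b a d).toMul : R) • u} := by
  classical
  have : Fintype (A ⧸ L) := L.fintypeQuotientOfFiniteIndex
  have : Fintype (D ⧸ E) := E.fintypeQuotientOfFiniteIndex
  let b' := quotientPairing b L E hL hE
  have hb' : ∀ (a : A) (d : D), b' (a : A ⧸ L) (d : D ⧸ E) = b a d := fun _ _ => rfl
  let f : A ⧸ L → V := Quotient.lift (fun a => π a v) (by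
    intro a a' h
    have h' : -a + a' ∈ L := QuotientAddGroup.leftRel_apply.1 h
    have : a' = a + (-a + a') := by abel
    rw [this, hπ, hv _ h'])
  have hf : ∀ a : A, f (a : A ⧸ L) = π a v := fun _ => rfl
  have hf' : ∀ (a : A) (q : A ⧸ L), π a (f q) = f ((a : A ⧸ L) + q) := by
    intro a q
    obtain ⟨q, rfl⟩ := QuotientAddGroup.mk_surjective q
    rw [← QuotientAddGroup.mk_add, hf, hf, hπ]
  let P : D ⧸ E → V := fun d => ∑ q, (((b' q d).toMul⁻¹ : Rˣ) : R) • f q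
  have hP : ∀ d, P d ∈ Submodule.span R {u | ∃ d, ∀ a, π a u = ((b a d).toMul : R) • u} := by
    intro d
    obtain ⟨d, rfl⟩ := QuotientAddGroup.mk_surjective d
    refine Submodule.subset_span ⟨d, fun a => ?_⟩
    simp only [P, map_sum, map_smul, hf', Finset.smul_sum]
    refine Fintype.sum_equiv (Equiv.addLeft (a : A ⧸ L)) _ _ fun q => ?_
    rw [Equiv.coe_addLeft, map_add, AddMonoidHom.add_apply, hb', toMul_add, smul_smul]
    congr 1
    simp only [mul_inv, Units.val_mul]
    rw [mul_left_comm, ← mul_assoc, Units.inv_mul, one_mul]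
  have hsum : ∑ d, P d = (E.index : R) • v := by
    simp only [P]
    rw [Finset.sum_comm]
    simp only [← Finset.sum_smul]
    rw [Finset.sum_eq_single (0 : A ⧸ L)]
    · have h0 : f 0 = v := by
        rw [← QuotientAddGroup.mk_zero, hf]
        exact hv 0 L.zero_mem
      simp [h0, AddSubgroup.index, Nat.card_eq_fintype_card]
    · intro q _ hq
      have h : -(b' q) ≠ 0 := by
        intro h0
        have h : b' q = 0 := by
          refine AddMonoidHom.ext fun d => ?_
          have := DFunLike.congr_fun h0 d
          simpa using this
        obtain ⟨q, rfl⟩ := QuotientAddGroup.mk_surjective q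
        refine hq ((QuotientAddGroup.eq_zero_iff _).2 (hsep q ?_))
        ext d
        rw [← hb', h]
        rfl
      have := sum_toMul_eq_zero _ h
      simp only [AddMonoidHom.neg_apply, toMul_neg] at this
      rw [this, zero_smul]
    · simp
  have : v = (E.index : R)⁻¹ • ∑ d, P d := by
    rw [hsum, smul_smul, inv_mul_cancel₀ hcard, one_smul]
  rw [this]
  exact Submodule.smul_mem _ _ (Submodule.sum_mem _ fun d _ => hP d)

theorem natCast_card_addSubgroup_ne_zero [Finite A] (h : (Nat.card A : R) ≠ 0)
    (N : AddSubgroup A) : (Nat.card N : R) ≠ 0 := by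
  obtain ⟨m, hm⟩ := N.card_addSubgroup_dvd_card
  intro h0
  exact h (by rw [hm, Nat.cast_mul, h0, zero_mul])

/-- For a pairing of finite groups without left kernel, a subgroup is its own double
annihilator. -/
theorem exists_annihilator_ne_zero_of_finite [Finite A] [Finite D] (b : A →+ D →+ Additive Rˣ)
    (hA : (Nat.card A : R) ≠ 0) (hD : (Nat.card D : R) ≠ 0) (hsep : ∀ a, b a = 0 → a = 0)
    (N : AddSubgroup A) (w : A) (hw : w ∉ N) :
    ∃ d, (∀ n ∈ N, b n d = 0) ∧ b w d ≠ 0 := by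
  classical
  by_contra! hcon
  have := Fintype.ofFinite A
  have := Fintype.ofFinite D
  let N' : AddSubgroup D :=
    { carrier := {d | ∀ n ∈ N, b n d = 0}
      add_mem' := fun hx hy n hn => by simp [hx n hn, hy n hn]
      zero_mem' := fun n _ => by simp
      neg_mem' := fun hx n hn => by simp [hx n hn] }
  -- Evaluate the sum of `b(w + n, d)` over `N × D` in both orders.
  have h1 : ∑ n : N, ∑ d, ((b (w + n) d).toMul : R) = 0 := by
    refine Finset.sum_eq_zero fun n _ => sum_toMul_eq_zero _ fun h => hw ?_
    have : w = -(n : A) := eq_neg_of_add_eq_zero_left (hsep _ h)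
    rw [this]
    exact N.neg_mem n.2
  have h2 : ∑ n : N, ∑ d, ((b (w + n) d).toMul : R) = Nat.card N * Nat.card N' := by
    rw [Finset.sum_comm]
    have h3 : ∀ d, ∑ n : N, ((b (w + n) d).toMul : R) = if d ∈ N' then (Nat.card N : R) else 0 := by
      intro d
      simp only [map_add, AddMonoidHom.add_apply, toMul_add, Units.val_mul, ← Finset.mul_sum]
      split_ifs with hd
      · rw [hcon d hd, Finset.sum_eq_card_nsmul (b := (1 : R))]
        · simp
        · intro n _
          rw [hd n n.2]
          simp
      · have : (b.flip d).comp N.subtype ≠ 0 := by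
          intro h
          exact hd fun n hn => DFunLike.congr_fun h ⟨n, hn⟩
        have := sum_toMul_eq_zero _ this
        simp only [AddMonoidHom.comp_apply, AddMonoidHom.flip_apply,
          AddSubgroup.subtype_apply] at this
        rw [this, mul_zero]
    simp only [h3]
    rw [← Finset.sum_filter, Finset.sum_const, nsmul_eq_mul, mul_comm]
    congr 2
    rw [Nat.card_eq_fintype_card, Fintype.card_subtype]
  rw [h1] at h2
  exact mul_ne_zero (natCast_card_addSubgroup_ne_zero hA N)
    (natCast_card_addSubgroup_ne_zero hD N') h2.symm

/-- The double annihilator property modulo subgroups of finite index. -/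
theorem exists_annihilator_ne_zero (b : A →+ D →+ Additive Rˣ) (L : AddSubgroup A)
    (E : AddSubgroup D) [L.FiniteIndex] [E.FiniteIndex] (hLcard : (L.index : R) ≠ 0)
    (hEcard : (E.index : R) ≠ 0) (hL : ∀ a ∈ L, b a = 0)
    (hE : ∀ a, ∀ d ∈ E, b a d = 0) (hsep : ∀ a, b a = 0 → a ∈ L)
    (N : AddSubgroup A) (hLN : L ≤ N) (w : A) (hw : w ∉ N) :
    ∃ d, (∀ n ∈ N, b n d = 0) ∧ b w d ≠ 0 := by
  have : Finite (A ⧸ L) := AddSubgroup.finite_quotient_of_finiteIndex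
  have : Finite (D ⧸ E) := AddSubgroup.finite_quotient_of_finiteIndex
  obtain ⟨d, hd, hwd⟩ := exists_annihilator_ne_zero_of_finite (quotientPairing b L E hL hE)
    hLcard hEcard
    (by
      intro q hq
      obtain ⟨a, rfl⟩ := QuotientAddGroup.mk_surjective q
      refine (QuotientAddGroup.eq_zero_iff _).2 (hsep a ?_)
      ext d
      exact congrArg _ (DFunLike.congr_fun hq (d : D ⧸ E)))
    (N.map (QuotientAddGroup.mk' L)) (w : A ⧸ L)
    (by
      rintro ⟨n, hn, h⟩
      have h' : -n + w ∈ L := QuotientAddGroup.eq.1 h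
      have : w = n + (-n + w) := by abel
      rw [this] at hw
      exact hw (N.add_mem hn (hLN h')))
  obtain ⟨d, rfl⟩ := QuotientAddGroup.mk_surjective d
  exact ⟨d, fun n hn => hd n ⟨n, hn, rfl⟩, hwd⟩

end FinitePairing

/-- A sum of joint eigenvectors whose eigencharacters are all nontrivial can only be an invariant
vector if it is zero. -/
theorem eq_zero_of_sum_eigenvectors {R V A ι : Type*} [Field R] [AddCommGroup V] [Module R V]
    (π : A → V →ₗ[R] V) (c : ι → A → R) (s : Finset ι) (hc : ∀ i ∈ s, ∃ a, c i a ≠ 1)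
    (u : ι → V) (hu : ∀ i ∈ s, ∀ a, π a (u i) = c i a • u i)
    (hinv : ∀ a, π a (∑ i ∈ s, u i) = ∑ i ∈ s, u i) : ∑ i ∈ s, u i = 0 := by
  classical
  induction s using Finset.induction_on generalizing u with
  | empty => simp
  | insert j s hj ih =>
    obtain ⟨a₀, ha₀⟩ := hc j (Finset.mem_insert_self _ _)
    -- Applying `π a₀ - c j a₀` removes the summand `u j`.
    have key : ∑ i ∈ s, (c i a₀ - c j a₀) • u i = (1 - c j a₀) • ∑ i ∈ insert j s, u i := by
      have h : ∑ i ∈ insert j s, (c i a₀ - c j a₀) • u i =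
          (1 - c j a₀) • ∑ i ∈ insert j s, u i := by
        have h' : (1 - c j a₀) • ∑ i ∈ insert j s, u i =
            π a₀ (∑ i ∈ insert j s, u i) - c j a₀ • ∑ i ∈ insert j s, u i := by
          rw [hinv, sub_smul, one_smul]
        rw [h', map_sum, Finset.smul_sum, ← Finset.sum_sub_distrib]
        exact Finset.sum_congr rfl fun i hi => by rw [hu i hi, sub_smul]
      rw [← h, Finset.sum_insert hj, sub_self, zero_smul, zero_add]
    have h0 := ih (fun i hi => hc i (Finset.mem_insert_of_mem hi))
      (fun i => (c i a₀ - c j a₀) • u i)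
      (fun i hi a => by
        rw [map_smul, hu i (Finset.mem_insert_of_mem hi), smul_comm])
      (fun a => by rw [key, map_smul, hinv])
    rw [key] at h0
    exact (smul_eq_zero.1 h0).resolve_left (sub_ne_zero.2 ha₀.symm)

/-! ### Orthogonals with respect to `ψ ∘ B` -/

section Orthogonal

variable {F : Type*} [Field F] {W : Type*} [AddCommGroup W] [Module F W]
  {R : Type*} [Field R]

/-- The pairing `(w, w') ↦ ψ(⟨w, w'⟩)` as a biadditive map. -/
def psiPairing (ψ : AddChar F Rˣ) (B : LinearMap.BilinForm F W) : W →+ W →+ Additive Rˣ :=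
  AddMonoidHom.mk' (fun w => ψ.toAddMonoidHom.comp (B w).toAddMonoidHom)
    (fun a b => AddMonoidHom.ext fun x => by
      simp only [map_add, AddMonoidHom.comp_apply, LinearMap.toAddMonoidHom_coe,
        LinearMap.add_apply, AddMonoidHom.add_apply])

variable {ψ : AddChar F Rˣ} {B : LinearMap.BilinForm F W}

theorem psi_swap (hB : B.IsAlt) (w w' : W) : ψ (B w w') = (ψ (B w' w))⁻¹ := by
  rw [← hB.neg_eq w' w, AddChar.map_neg_eq_inv]

theorem psi_swap_eq_one_iff (hB : B.IsAlt) (w w' : W) : ψ (B w w') = 1 ↔ ψ (B w' w) = 1 := by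
  rw [psi_swap hB, inv_eq_one]

theorem psiOrthogonal_anti {A A' : AddSubgroup W} (h : A ≤ A') :
    psiOrthogonal ψ B A' ≤ psiOrthogonal ψ B A :=
  fun _ hw a ha => hw a (h ha)

theorem IsSelfDual.mem_iff {A : AddSubgroup W} (hA : IsSelfDual ψ B A) {w : W} :
    w ∈ A ↔ ∀ a ∈ A, ψ (B w a) = 1 := by
  constructor
  · intro h
    rw [hA] at h
    exact h
  · intro h
    rw [hA]
    exact h

end Orthogonal

section Topology

variable {F : Type*} [Field F] [TopologicalSpace F]
  {W : Type*} [AddCommGroup W] [Module F W] [TopologicalSpace W]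
  [IsModuleTopology F W] {R : Type*} [Field R] {ψ : AddChar F Rˣ}
  {B : LinearMap.BilinForm F W} {p : ℕ}

theorem exists_pow_psi_eq_one [IsTopologicalRing F] (hpF : IsTopologicallyNilpotent (p : F))
    (hψ : IsLocallyConstant ψ) (x : F) : ∃ n : ℕ, ψ x ^ p ^ n = 1 := by
  have hopen : IsOpen {y : F | ψ (y * x) = 1} :=
    (hψ.isOpen_fiber 1).preimage (continuous_mul_const x)
  obtain ⟨n, hn⟩ := hpF.exists_pow_mem_of_mem_nhds (hopen.mem_nhds (by simp))
  have hn : ψ ((p : F) ^ n * x) = 1 := hn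
  refine ⟨n, ?_⟩
  rw [← AddChar.map_nsmul_eq_pow, nsmul_eq_mul]
  simpa using hn

theorem ringChar_ne_of_isTopologicallyNilpotent [IsTopologicalRing F] (hp : p.Prime)
    (hpF : IsTopologicallyNilpotent (p : F)) (hψ : IsLocallyConstant ψ) (hψ1 : ψ ≠ 1) :
    ringChar R ≠ p := by
  intro h
  have : CharP R p := ringChar.of_eq h
  have : Fact p.Prime := ⟨hp⟩
  refine hψ1 (DFunLike.ext _ _ fun x => ?_)
  obtain ⟨n, hn⟩ := exists_pow_psi_eq_one hpF hψ x
  have h1 : ((ψ x : R) - 1) ^ p ^ n = 0 := by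
    rw [sub_pow_char_pow, one_pow, ← Units.val_pow_eq_pow_val, hn, Units.val_one, sub_self]
  have h2 : (ψ x : R) = 1 := sub_eq_zero.1 (pow_eq_zero_iff (pow_pos hp.pos n).ne' |>.1 h1)
  exact Units.ext h2

theorem exists_pow_nsmul_mem (hpF : IsTopologicallyNilpotent (p : F)) {M : AddSubgroup W}
    (hM : IsOpen (M : Set W)) (w : W) : ∃ n : ℕ, p ^ n • w ∈ M := by
  have hc : Continuous fun x : F => x • w := by fun_prop
  obtain ⟨n, hn⟩ := hpF.exists_pow_mem_of_mem_nhds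
    ((hM.preimage hc).mem_nhds (by simp : (0 : F) • w ∈ (M : Set W)))
  refine ⟨n, ?_⟩
  have : (p : F) ^ n • w ∈ M := hn
  rwa [← Nat.cast_pow, Nat.cast_smul_eq_nsmul] at this

/-- Finite quotients by open subgroups are `p`-groups, so their order is invertible in `R`. -/
theorem natCast_index_ne_zero (hp : p.Prime) (hpF : IsTopologicallyNilpotent (p : F))
    (hR : ringChar R ≠ p) {N : AddSubgroup W} (hN : IsOpen (N : Set W)) (K : AddSubgroup W)
    [(N.addSubgroupOf K).FiniteIndex] : ((N.addSubgroupOf K).index : R) ≠ 0 := by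
  intro h0
  have hdvd := (ringChar.spec R _).1 h0
  have hne : (N.addSubgroupOf K).index ≠ 0 := AddSubgroup.FiniteIndex.index_ne_zero
  have hq : (ringChar R).Prime := by
    rcases CharP.char_is_prime_or_zero R (ringChar R) with h | h
    · exact h
    · rw [h, zero_dvd_iff] at hdvd
      exact absurd hdvd hne
  have : Fact (ringChar R).Prime := ⟨hq⟩
  have : Fintype (K ⧸ N.addSubgroupOf K) := AddSubgroup.fintypeQuotientOfFiniteIndex
  rw [AddSubgroup.index, Nat.card_eq_fintype_card] at hdvd
  obtain ⟨x, hx⟩ := exists_prime_addOrderOf_dvd_card _ hdvd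
  obtain ⟨k, rfl⟩ := QuotientAddGroup.mk_surjective x
  obtain ⟨n, hn⟩ := exists_pow_nsmul_mem hpF hN (k : W)
  have h1 : p ^ n • (k : K ⧸ N.addSubgroupOf K) = 0 := by
    rw [← QuotientAddGroup.mk_nsmul, QuotientAddGroup.eq_zero_iff, AddSubgroup.mem_addSubgroupOf]
    exact hn
  have h2 := addOrderOf_dvd_of_nsmul_eq_zero h1
  rw [hx] at h2
  exact hR ((Nat.prime_dvd_prime_iff_eq hq hp).1 (hq.dvd_of_dvd_pow h2))

theorem finiteIndex_of_isOpen_of_isCompact {W : Type*} [AddCommGroup W] [TopologicalSpace W]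
    [IsTopologicalAddGroup W] {N K : AddSubgroup W} (hN : IsOpen (N : Set W))
    (hK : IsCompact (K : Set W)) : (N.addSubgroupOf K).FiniteIndex := by
  have : CompactSpace K := isCompact_iff_compactSpace.1 hK
  have : Finite (K ⧸ N.addSubgroupOf K) :=
    AddSubgroup.quotient_finite_of_isOpen _ (hN.preimage continuous_subtype_val)
  exact AddSubgroup.finiteIndex_of_finite_quotient

variable [IsTopologicalRing F]

theorem continuous_bilin_right (w : W) : Continuous fun w' : W => B w w' :=
  IsModuleTopology.continuous_of_linearMap (B w)

theorem isClopen_psi_eq_one (hψ : IsLocallyConstant ψ) (w : W) :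
    IsClopen {w' : W | ψ (B w w') = 1} :=
  (hψ.isClopen_fiber 1).preimage (continuous_bilin_right w)

variable (ψ B) in
/-- A compact open self-dual subgroup `Λ` containing arbitrarily small open subgroups which are
closed for the duality defined by `ψ ∘ B`. For a finite field every Lagrangian is one; for a
local field every self-dual lattice is one. -/
structure IsGoodLattice (Λ : AddSubgroup W) : Prop where
  selfDual : IsSelfDual ψ B Λ
  isOpen : IsOpen (Λ : Set W)
  isCompact : IsCompact (Λ : Set W)
  exists_le : ∀ U ∈ nhds (0 : W), ∃ L : AddSubgroup W, L ≤ Λ ∧ (L : Set W) ⊆ U ∧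
    IsOpen (L : Set W) ∧ IsCompact (psiOrthogonal ψ B L : Set W) ∧
    psiOrthogonal ψ B (psiOrthogonal ψ B L) ≤ L

namespace IsGoodLattice

variable {Λ : AddSubgroup W}

/-- Open subgroups containing `Λ` are closed for the duality. Compactness of `Λ` reduces this to
the duality between the finite groups `K ⧸ Λ` and `Λ ⧸ L`, where `K` is the orthogonal of a small
open subgroup `L`. -/
theorem psiOrthogonal_psiOrthogonal_le (hΛ : IsGoodLattice ψ B Λ) (hB : B.IsAlt)
    (hψ : IsLocallyConstant ψ) (hp : p.Prime) (hpF : IsTopologicallyNilpotent (p : F))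
    (hR : ringChar R ≠ p) {M : AddSubgroup W} (hM : Λ ≤ M) :
    psiOrthogonal ψ B (psiOrthogonal ψ B M) ≤ M := by
  have : IsTopologicalAddGroup W := IsModuleTopology.topologicalAddGroup F W
  intro w hw
  by_contra hwM
  have hempty : (Λ : Set W) ∩ ⋂ m : M, ({y : W | ψ (B w y) ≠ 1} ∩ {y | ψ (B (m : W) y) = 1}) =
      ∅ := by
    ext y
    simp only [Set.mem_inter_iff, Set.mem_iInter, Set.mem_ofPred_eq, Set.mem_empty_iff_false,
      iff_false, not_and]
    intro _ hy
    exact (hy 0).1 (hw y fun m hm => (psi_swap_eq_one_iff hB _ _).1 (hy ⟨m, hm⟩).2)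
  obtain ⟨t, ht⟩ := hΛ.isCompact.elim_finite_subfamily_closed _
    (fun m : M => ((isClopen_psi_eq_one (B := B) hψ w).compl.1).inter
      (isClopen_psi_eq_one (B := B) hψ (m : W)).1) hempty
  have hU : (⋂ m ∈ t, {y : W | ψ (B (m : W) y) = 1}) ∩ {y | ψ (B w y) = 1} ∈ nhds (0 : W) := by
    refine Filter.inter_mem ((Filter.biInter_finset_mem t).2 fun m _ => ?_) ?_
    · exact (isClopen_psi_eq_one hψ (m : W)).2.mem_nhds (by simp)
    · exact (isClopen_psi_eq_one hψ w).2.mem_nhds (by simp)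
  obtain ⟨L, hLΛ, hLU, hLo, hLc, -⟩ := hΛ.exists_le _ hU
  let K := psiOrthogonal ψ B L
  have hwK : w ∈ K := fun l hl => (hLU hl).2
  have htK : ∀ m ∈ t, (m : W) ∈ K := fun m hm l hl => Set.mem_iInter₂.1 (hLU hl).1 m hm
  have := finiteIndex_of_isOpen_of_isCompact hΛ.isOpen hLc
  have := finiteIndex_of_isOpen_of_isCompact hLo hΛ.isCompact
  obtain ⟨d, hd, hwd⟩ := exists_annihilator_ne_zero
    (((psiPairing ψ B).comp K.subtype).compl₂ Λ.subtype)
    (Λ.addSubgroupOf K) (L.addSubgroupOf Λ)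
    (natCast_index_ne_zero hp hpF hR hΛ.isOpen K) (natCast_index_ne_zero hp hpF hR hLo Λ)
    (fun a ha => AddMonoidHom.ext fun d => hΛ.selfDual.mem_iff.1 ha d d.2)
    (fun a d hd => a.2 d hd)
    (fun a ha => hΛ.selfDual.mem_iff.2 fun l hl => DFunLike.congr_fun ha ⟨l, hl⟩)
    (M.addSubgroupOf K) (fun a ha => hM ha) ⟨w, hwK⟩ hwM
  have : (d : W) ∈ (Λ : Set W) ∩
      ⋂ m ∈ t, ({y : W | ψ (B w y) ≠ 1} ∩ {y | ψ (B ((m : M) : W) y) = 1}) := by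
    refine ⟨d.2, Set.mem_iInter₂.2 fun m hm => ⟨hwd, hd ⟨m, htK m hm⟩ m.2⟩⟩
  exact ht.subset this

theorem psiOrthogonal_inf_le (hΛ : IsGoodLattice ψ B Λ) (hB : B.IsAlt)
    (hψ : IsLocallyConstant ψ) (hp : p.Prime) (hpF : IsTopologicallyNilpotent (p : F))
    (hR : ringChar R ≠ p) {A : AddSubgroup W} (hA : IsSelfDual ψ B A) :
    psiOrthogonal ψ B (A ⊓ Λ) ≤ A ⊔ Λ := by
  refine le_trans (psiOrthogonal_anti ?_)
    (hΛ.psiOrthogonal_psiOrthogonal_le hB hψ hp hpF hR le_sup_right)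
  refine le_inf ?_ ?_
  · conv_rhs => rw [hA]
    exact psiOrthogonal_anti le_sup_left
  · conv_rhs => rw [hΛ.selfDual]
    exact psiOrthogonal_anti le_sup_right

end IsGoodLattice

end Topology

/-! ### Eigenspaces of a self-dual subgroup in a smooth representation -/

/-- `ρ` is a smooth representation of the Heisenberg group with central character `ψ`. -/
structure IsSmoothPsiRep {F : Type*} [Field F] [TopologicalSpace F]
    {W : Type*} [AddCommGroup W] [Module F W] [TopologicalSpace W]
    (B : LinearMap.BilinForm F W) {R : Type*} [Field R] (ψ : AddChar F Rˣ)
    {V : Type*} [AddCommGroup V] [Module R V] (ρ : Representation R (Heisenberg B) V) :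
    Prop where
  smooth : IsSmoothRep ρ
  central : ∀ (t : F) (v : V), ρ ⟨0, t⟩ v = ((ψ t : Rˣ) : R) • v

namespace Heisenberg

variable {F : Type*} [Field F] {W : Type*} [AddCommGroup W] [Module F W]
  {B : LinearMap.BilinForm F W}

theorem mul_comm_of_isAlt (hB : B.IsAlt) (h2 : (2 : F) ≠ 0) (g h : Heisenberg B) :
    h * g = g * h * ⟨0, B h.vec g.vec⟩ := by
  ext
  · simp [add_comm]
  · have := hB.neg_eq h.vec g.vec
    simp only [mul_scalar, mul_vec, map_zero, zero_div, add_zero, ← this]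
    field_simp
    ring

/-- The element `(a, 0)` of `A × F`. -/
def ofVec (B : LinearMap.BilinForm F W) (A : AddSubgroup W) (a : A) : preimage B A :=
  ⟨⟨a, 0⟩, a.2⟩

theorem ofVec_mul_central (A : AddSubgroup W) (a : A) (t : F) :
    ofVec B A a * central B A t = ⟨⟨a, t⟩, a.2⟩ := by
  ext <;> simp [ofVec, central]

theorem ofVec_mul_ofVec (A : AddSubgroup W) (a a' : A) :
    ofVec B A a * ofVec B A a' = ofVec B A (a + a') * central B A (B a a' / 2) := by
  ext <;> simp [ofVec, central]

theorem eq_ofVec_mul_central {A : AddSubgroup W} (h : preimage B A) :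
    h = ofVec B A ⟨(h : Heisenberg B).vec, h.2⟩ * central B A (h : Heisenberg B).scalar := by
  rw [ofVec_mul_central]

theorem continuous_ofVec [TopologicalSpace F] [TopologicalSpace W] (t : F) :
    Continuous fun w : W => (⟨w, t⟩ : Heisenberg B) :=
  continuous_induced_rng.2 (continuous_id.prodMk continuous_const)

end Heisenberg

section Algebraic

variable {F : Type*} [Field F] {W : Type*} [AddCommGroup W] [Module F W]
  {R : Type*} [Field R] {ψ : AddChar F Rˣ}
  {B : LinearMap.BilinForm F W} {A Λ : AddSubgroup W}

variable {V : Type*} [AddCommGroup V] [Module R V] {ρ : Representation R (Heisenberg B) V}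
  {χ : preimage B Λ →* Rˣ}

variable (ψ ρ χ) in
/-- The vectors on which `Λ × F` acts through the conjugate of the character `χ` by `w`, that is
through `h ↦ χ(h) ψ(⟨h, w⟩)`. -/
def conjEigenspace (w : W) : Submodule R V where
  carrier := {v | ∀ h : preimage B Λ,
    ρ h v = ((χ h * ψ (B (h : Heisenberg B).vec w) : Rˣ) : R) • v}
  add_mem' hx hy h := by rw [map_add, hx h, hy h, smul_add]
  zero_mem' h := by simp
  smul_mem' c x hx h := by rw [map_smul, hx h, smul_comm]

variable (ρ χ) in
/-- The action of `Λ` on `V` twisted by the inverse of `χ`. As the centre acts through `ψ`, it is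
a representation of the abelian group `Λ`. -/
noncomputable def twistedAction (a : Λ) : V →ₗ[R] V :=
  (((χ (ofVec B Λ a))⁻¹ : Rˣ) : R) • ρ (ofVec B Λ a : Heisenberg B)

theorem twistedAction_apply_of_mem {w : W} {v : V} (hv : v ∈ conjEigenspace ψ ρ χ w) (a : Λ) :
    twistedAction ρ χ a v = ((ψ (B a w) : Rˣ) : R) • v := by
  rw [twistedAction, LinearMap.smul_apply, hv (ofVec B Λ a), smul_smul, ← Units.val_mul,
    inv_mul_cancel_left]
  rfl

variable [TopologicalSpace F] [TopologicalSpace W]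

theorem IsSmoothExtension.exists_nhds {χ : preimage B A →* Rˣ} (hχ : IsSmoothExtension ψ B A χ) :
    ∃ U ∈ nhds (0 : W), ∀ a : A, (a : W) ∈ U → χ (ofVec B A a) = 1 := by
  have hc : Continuous (ofVec B A) :=
    Continuous.subtype_mk ((continuous_ofVec 0).comp continuous_subtype_val) _
  obtain ⟨U, hU, hUeq⟩ := isOpen_induced_iff.1 ((hχ.1.isOpen_fiber 1).preimage hc)
  have hmem : ∀ a : A, (a : W) ∈ U ↔ χ (ofVec B A a) = 1 := fun a => Set.ext_iff.1 hUeq a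
  refine ⟨U, hU.mem_nhds ?_, fun a => (hmem a).1⟩
  exact (hmem 0).2 (map_one χ)

theorem IsSmoothRep.exists_nhds (hρ : IsSmoothRep ρ) (v : V) :
    ∃ U ∈ nhds (0 : W), ∀ w ∈ U, ρ ⟨w, 0⟩ v = v := by
  refine ⟨_, ((hρ v).preimage (continuous_ofVec 0)).mem_nhds ?_, fun w hw => hw⟩
  change ρ 1 v = v
  simp

theorem IsSmoothPsiRep.apply_mem_conjEigenspace (hρ : IsSmoothPsiRep B ψ ρ) (hB : B.IsAlt)
    (h2 : (2 : F) ≠ 0) (g : Heisenberg B) {w : W} {v : V} (hv : v ∈ conjEigenspace ψ ρ χ w) :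
    ρ g v ∈ conjEigenspace ψ ρ χ (w + g.vec) := by
  intro h
  rw [← Module.End.mul_apply, ← map_mul, mul_comm_of_isAlt hB h2, map_mul, map_mul,
    Module.End.mul_apply, Module.End.mul_apply, hρ.central, map_smul, map_smul, hv h, map_smul,
    smul_smul]
  simp only [map_add, AddChar.map_add_eq_mul, Units.val_mul]
  congr 1
  ring

theorem twistedAction_add (hχ : IsSmoothExtension ψ B Λ χ) (hρ : IsSmoothPsiRep B ψ ρ)
    (a a' : Λ) (v : V) :
    twistedAction ρ χ (a + a') v = twistedAction ρ χ a (twistedAction ρ χ a' v) := by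
  have h1 : χ (ofVec B Λ a) * χ (ofVec B Λ a') = χ (ofVec B Λ (a + a')) * ψ (B a a' / 2) := by
    rw [← map_mul, ofVec_mul_ofVec, map_mul, hχ.2]
  have h2 : ρ (ofVec B Λ a : Heisenberg B) (ρ (ofVec B Λ a' : Heisenberg B) v) =
      ((ψ (B a a' / 2) : Rˣ) : R) • ρ (ofVec B Λ (a + a') : Heisenberg B) v := by
    rw [← Module.End.mul_apply, ← map_mul, ← Subgroup.coe_mul, ofVec_mul_ofVec,
      Subgroup.coe_mul, map_mul, Module.End.mul_apply]
    change ρ _ (ρ ⟨0, _⟩ v) = _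
    rw [hρ.central, map_smul]
  simp only [twistedAction, LinearMap.smul_apply, map_smul, h2, smul_smul]
  congr 1
  rw [← Units.val_mul, ← Units.val_mul, Units.val_inj, eq_inv_mul_iff_mul_eq,
    eq_inv_mul_iff_mul_eq, ← mul_assoc, h1, mul_comm (χ _),
    mul_inv_cancel_right]

theorem mem_conjEigenspace_of_twistedAction (hχ : IsSmoothExtension ψ B Λ χ)
    (hρ : IsSmoothPsiRep B ψ ρ) {w : W} {v : V}
    (hv : ∀ a : Λ, twistedAction ρ χ a v = ((ψ (B a w) : Rˣ) : R) • v) :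
    v ∈ conjEigenspace ψ ρ χ w := by
  intro h
  have h1 : ∀ a : Λ, ρ (ofVec B Λ a : Heisenberg B) v =
      ((χ (ofVec B Λ a) * ψ (B a w) : Rˣ) : R) • v := by
    intro a
    rw [Units.val_mul, mul_smul, ← hv a, twistedAction, LinearMap.smul_apply, smul_smul,
      ← Units.val_mul, mul_inv_cancel, Units.val_one, one_smul]
  have h2 : ∀ t, ρ (central B Λ t : Heisenberg B) v = ((ψ t : Rˣ) : R) • v :=
    fun t => hρ.central t v
  rw [eq_ofVec_mul_central h, Subgroup.coe_mul, map_mul, Module.End.mul_apply, h2, map_smul, h1,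
    smul_smul, map_mul, hχ.2]
  simp only [Units.val_mul]
  rw [mul_assoc (χ _ : R), mul_left_comm]
  simp only [mul_vec, ofVec, central, add_zero]

/-- The only translates of an eigenvector `v` that contribute to the eigenspace of `v` are those
by elements of `Λ`, and these are multiples of `v`. -/
theorem mem_span_singleton_of_mem_conjEigenspace (hΛ : IsSelfDual ψ B Λ)
    (hρ : IsSmoothPsiRep B ψ ρ) (hB : B.IsAlt) (h2 : (2 : F) ≠ 0) {v u : V}
    (hv : v ∈ conjEigenspace ψ ρ χ 0) (hu : u ∈ conjEigenspace ψ ρ χ 0)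
    (huv : u ∈ Submodule.span R (Set.range fun g => ρ g v)) : u ∈ Submodule.span R {v} := by
  classical
  obtain ⟨c, rfl⟩ := (Finsupp.mem_span_range_iff_exists_finsupp).1 huv
  have hmem : ∀ g, c g • ρ g v ∈ conjEigenspace ψ ρ χ g.vec := fun g =>
    Submodule.smul_mem _ _ (by simpa using hρ.apply_mem_conjEigenspace hB h2 g hv)
  have hin : ∀ g : Heisenberg B, g.vec ∈ Λ → ρ g v ∈ Submodule.span R {v} := by
    intro g hg
    have := hv ⟨g, hg⟩
    rw [show ρ g v = _ from this]
    exact Submodule.smul_mem _ _ (Submodule.mem_span_singleton_self v)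
  have hin' : ∀ s : Finset (Heisenberg B), (∀ g ∈ s, g.vec ∈ Λ) →
      ∑ g ∈ s, c g • ρ g v ∈ Submodule.span R {v} := fun s hs =>
    Submodule.sum_mem _ fun g hg => Submodule.smul_mem _ _ (hin g (hs g hg))
  have hv0 : Submodule.span R {v} ≤ conjEigenspace ψ ρ χ 0 := by
    rwa [Submodule.span_singleton_le_iff_mem]
  have hsplit := Finset.sum_filter_add_sum_filter_not c.support (fun g => g.vec ∈ Λ)
    (fun g => c g • ρ g v)
  have hzero : ∑ g ∈ c.support.filter (fun g => g.vec ∉ Λ), c g • ρ g v = 0 := by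
    refine eq_zero_of_sum_eigenvectors (twistedAction ρ χ)
      (fun g a => ((ψ (B a g.vec) : Rˣ) : R)) _ ?_ _ ?_ ?_
    · intro g hg
      by_contra! hcon
      refine (Finset.mem_filter.1 hg).2 (hΛ.mem_iff.2 fun a ha => ?_)
      rw [psi_swap_eq_one_iff hB]
      exact Units.ext (hcon ⟨a, ha⟩)
    · exact fun g _ a => twistedAction_apply_of_mem (hmem g) a
    · intro a
      have h0 : ∑ g ∈ c.support.filter (fun g => g.vec ∉ Λ), c g • ρ g v ∈
          conjEigenspace ψ ρ χ 0 := by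
        rw [← eq_sub_iff_add_eq'] at hsplit
        rw [hsplit]
        exact Submodule.sub_mem _ hu (hv0 (hin' _ fun g hg => (Finset.mem_filter.1 hg).2))
      rw [twistedAction_apply_of_mem h0]
      simp
  rw [Finsupp.sum, ← hsplit, hzero, add_zero]
  exact hin' _ fun g hg => (Finset.mem_filter.1 hg).2

end Algebraic

/-! ### Irreducibility and uniqueness -/

section Irreducible

variable {F : Type*} [Field F] [TopologicalSpace F]
  {W : Type*} [AddCommGroup W] [Module F W] [TopologicalSpace W]
  {R : Type*} [Field R] {ψ : AddChar F Rˣ} {B : LinearMap.BilinForm F W} {p : ℕ}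
  {Λ : AddSubgroup W} {χ : preimage B Λ →* Rˣ}
  {V : Type*} [AddCommGroup V] [Module R V] {ρ : Representation R (Heisenberg B) V}

theorem IsSmoothPsiRep.toRepresentation (hρ : IsSmoothPsiRep B ψ ρ) (U : Subrepresentation ρ) :
    IsSmoothPsiRep B ψ U.toRepresentation where
  smooth u := by
    convert! hρ.smooth (u : V) using 3
    exact Subtype.ext_iff
  central t u := Subtype.ext (hρ.central t u)

variable [IsModuleTopology F W]

/-- Every smooth representation with central character `ψ` is the sum of the eigenspaces of
`Λ × F` for the conjugates of `χ`. -/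
theorem mem_span_conjEigenspace (hΛ : IsGoodLattice ψ B Λ) (hB : B.IsAlt)
    (hp : p.Prime) (hpF : IsTopologicallyNilpotent (p : F))
    (hR : ringChar R ≠ p) (hχ : IsSmoothExtension ψ B Λ χ) (hρ : IsSmoothPsiRep B ψ ρ) (v : V) :
    v ∈ Submodule.span R {u | ∃ w, u ∈ conjEigenspace ψ ρ χ w} := by
  have : IsTopologicalAddGroup W := IsModuleTopology.topologicalAddGroup F W
  obtain ⟨U₁, hU₁, hU₁'⟩ := hχ.exists_nhds
  obtain ⟨U₂, hU₂, hU₂'⟩ := hρ.smooth.exists_nhds v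
  obtain ⟨L, hLΛ, hLU, hLo, hLc, hLL⟩ := hΛ.exists_le _ (Filter.inter_mem hU₁ hU₂)
  let K := psiOrthogonal ψ B L
  have := finiteIndex_of_isOpen_of_isCompact hΛ.isOpen hLc
  have := finiteIndex_of_isOpen_of_isCompact hLo hΛ.isCompact
  refine Submodule.span_mono ?_ (mem_span_eigenvectors
    (((psiPairing ψ B).comp Λ.subtype).compl₂ K.subtype)
    (L.addSubgroupOf Λ) (Λ.addSubgroupOf K) (natCast_index_ne_zero hp hpF hR hΛ.isOpen K)
    (fun a ha => AddMonoidHom.ext fun y => (psi_swap_eq_one_iff hB _ _).1 (y.2 a ha))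
    (fun a y hy => hΛ.selfDual.mem_iff.1 a.2 y hy)
    (fun a ha => hLL fun y hy => DFunLike.congr_fun ha ⟨y, hy⟩)
    (twistedAction ρ χ) (twistedAction_add hχ hρ) v fun a ha => ?_)
  · rintro u ⟨y, hy⟩
    exact ⟨y, mem_conjEigenspace_of_twistedAction hχ hρ hy⟩
  · rw [twistedAction, hU₁' a (hLU ha).1, inv_one, Units.val_one, one_smul]
    exact hU₂' a (hLU ha).2

/-- Translation carries every eigenspace into that of `χ`, which therefore generates. -/
theorem eq_top_of_conjEigenspace_le (hΛ : IsGoodLattice ψ B Λ) (hB : B.IsAlt) (h2 : (2 : F) ≠ 0)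
    (hp : p.Prime) (hpF : IsTopologicallyNilpotent (p : F))
    (hR : ringChar R ≠ p) (hχ : IsSmoothExtension ψ B Λ χ) (hρ : IsSmoothPsiRep B ψ ρ)
    (U : Subrepresentation ρ) (hU : conjEigenspace ψ ρ χ 0 ≤ U.toSubmodule) : U = ⊤ := by
  refine Subrepresentation.toSubmodule_injective (eq_top_iff.2 fun v _ => ?_)
  refine Submodule.span_le.2 ?_ (mem_span_conjEigenspace hΛ hB hp hpF hR hχ hρ v)
  rintro u ⟨w, hw⟩
  have h1 : ρ (⟨w, 0⟩ : Heisenberg B)⁻¹ u ∈ U.toSubmodule :=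
    hU (by simpa using hρ.apply_mem_conjEigenspace hB h2 (⟨w, 0⟩ : Heisenberg B)⁻¹ hw)
  have := U.apply_mem_toSubmodule ⟨w, 0⟩ h1
  rwa [← Module.End.mul_apply, ← map_mul, mul_inv_cancel, map_one] at this

theorem conjEigenspace_ne_bot [Nontrivial V] (hΛ : IsGoodLattice ψ B Λ) (hB : B.IsAlt)
    (h2 : (2 : F) ≠ 0) (hp : p.Prime) (hpF : IsTopologicallyNilpotent (p : F))
    (hR : ringChar R ≠ p) (hχ : IsSmoothExtension ψ B Λ χ) (hρ : IsSmoothPsiRep B ψ ρ) :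
    conjEigenspace ψ ρ χ 0 ≠ ⊥ := by
  intro h
  have := eq_top_of_conjEigenspace_le hΛ hB h2 hp hpF hR hχ hρ ⊥ (by rw [h]; exact bot_le)
  exact bot_ne_top (congrArg Subrepresentation.toSubmodule this : (⊥ : Submodule R V) = ⊤)

theorem Representation.IsIrreducible.nontrivial_module {G : Type*} [Monoid G]
    {ρ : Representation R G V} (hρ : ρ.IsIrreducible) : Nontrivial V := by
  by_contra hcon
  rw [not_nontrivial_iff_subsingleton] at hcon
  exact bot_ne_top (α := Subrepresentation ρ)
    (Subrepresentation.toSubmodule_injective (Subsingleton.elim _ _))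

/-- A smooth representation with central character `ψ` in which `χ` has multiplicity one is
irreducible. -/
theorem isIrreducible_of_conjEigenspace_le [Nontrivial V] (hΛ : IsGoodLattice ψ B Λ) (hB : B.IsAlt)
    (h2 : (2 : F) ≠ 0) (hp : p.Prime) (hpF : IsTopologicallyNilpotent (p : F))
    (hR : ringChar R ≠ p) (hχ : IsSmoothExtension ψ B Λ χ) (hρ : IsSmoothPsiRep B ψ ρ)
    {v₀ : V} (hv₀ : conjEigenspace ψ ρ χ 0 ≤ Submodule.span R {v₀}) : ρ.IsIrreducible := by
  have : Nontrivial (Subrepresentation ρ) := ⟨⊥, ⊤, fun h =>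
    bot_ne_top (congrArg Subrepresentation.toSubmodule h : (⊥ : Submodule R V) = ⊤)⟩
  refine ⟨fun U => ?_⟩
  by_cases hU : U.toSubmodule = ⊥
  · exact Or.inl (Subrepresentation.toSubmodule_injective hU)
  · right
    have : Nontrivial U.toSubmodule := Submodule.nontrivial_iff_ne_bot.2 hU
    obtain ⟨u, hu, hu0⟩ := Submodule.exists_mem_ne_zero_of_ne_bot
      (conjEigenspace_ne_bot hΛ hB h2 hp hpF hR hχ (hρ.toRepresentation U))
    have hu' : (u : V) ∈ conjEigenspace ψ ρ χ 0 := fun h => congrArg Subtype.val (hu h)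
    obtain ⟨c, hc⟩ := Submodule.mem_span_singleton.1 (hv₀ hu')
    refine eq_top_of_conjEigenspace_le hΛ hB h2 hp hpF hR hχ hρ U (hv₀.trans ?_)
    rw [Submodule.span_singleton_le_iff_mem]
    have hc0 : c ≠ 0 := by
      rintro rfl
      rw [zero_smul] at hc
      exact hu0 (Subtype.ext hc.symm)
    have := U.toSubmodule.smul_mem c⁻¹ u.2
    rwa [← hc, smul_smul, inv_mul_cancel₀ hc0, one_smul] at this

/-- Two irreducible smooth representations with central character `ψ` are isomorphic: the
subrepresentation of their product generated by a pair of nonzero eigenvectors is the graph of an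
isomorphism, because `χ` has multiplicity one in it. -/
theorem nonempty_equiv {V₁ V₂ : Type*} [AddCommGroup V₁] [Module R V₁] [AddCommGroup V₂]
    [Module R V₂] {ρ₁ : Representation R (Heisenberg B) V₁}
    {ρ₂ : Representation R (Heisenberg B) V₂}
    (hΛ : IsGoodLattice ψ B Λ) (hB : B.IsAlt)
    (h2 : (2 : F) ≠ 0) (hp : p.Prime) (hpF : IsTopologicallyNilpotent (p : F))
    (hR : ringChar R ≠ p) (hχ : IsSmoothExtension ψ B Λ χ)
    (h₁ : IsHeisenbergRep B ψ ρ₁) (h₂ : IsHeisenbergRep B ψ ρ₂) :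
    Nonempty (Representation.Equiv ρ₁ ρ₂) := by
  have hs₁ : IsSmoothPsiRep B ψ ρ₁ := ⟨h₁.smooth, h₁.central⟩
  have hs₂ : IsSmoothPsiRep B ψ ρ₂ := ⟨h₂.smooth, h₂.central⟩
  have hs : IsSmoothPsiRep B ψ (ρ₁.prod ρ₂) :=
    { smooth := fun v => by
        convert! (h₁.smooth v.1).inter (h₂.smooth v.2) using 1
        ext g
        exact Prod.ext_iff
      central := fun t v => Prod.ext (h₁.central t v.1) (h₂.central t v.2) }
  have hi₁ := h₁.irreducible
  have hi₂ := h₂.irreducible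
  have := hi₁.nontrivial_module
  have := hi₂.nontrivial_module
  obtain ⟨v₁, hv₁, hv₁0⟩ := Submodule.exists_mem_ne_zero_of_ne_bot
    (conjEigenspace_ne_bot hΛ hB h2 hp hpF hR hχ hs₁)
  obtain ⟨v₂, hv₂, hv₂0⟩ := Submodule.exists_mem_ne_zero_of_ne_bot
    (conjEigenspace_ne_bot hΛ hB h2 hp hpF hR hχ hs₂)
  have hv : (v₁, v₂) ∈ conjEigenspace ψ (ρ₁.prod ρ₂) χ 0 := fun h => Prod.ext (hv₁ h) (hv₂ h)
  let U : Submodule R (V₁ × V₂) :=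
    Submodule.span R (Set.range fun g => (ρ₁.prod ρ₂) g (v₁, v₂))
  have hUv : (v₁, v₂) ∈ U := Submodule.subset_span ⟨1, by simp⟩
  have hUg : ∀ g, ∀ u ∈ U, (ρ₁.prod ρ₂) g u ∈ U := by
    intro g u hu
    have : U ≤ U.comap ((ρ₁.prod ρ₂) g) := by
      refine Submodule.span_le.2 ?_
      rintro _ ⟨g', rfl⟩
      refine Submodule.subset_span ⟨g * g', ?_⟩
      simp only [map_mul, Module.End.mul_apply]
    exact this hu
  have hmult : ∀ u ∈ U, u ∈ conjEigenspace ψ (ρ₁.prod ρ₂) χ 0 →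
      ∃ c : R, c • (v₁, v₂) = u := fun u hu hu' =>
    Submodule.mem_span_singleton.1
      (mem_span_singleton_of_mem_conjEigenspace hΛ.selfDual hs hB h2 hv hu' hu)
  let f₁ : U →ₗ[R] V₁ := (LinearMap.fst R V₁ V₂).comp U.subtype
  let f₂ : U →ₗ[R] V₂ := (LinearMap.snd R V₁ V₂).comp U.subtype
  have hf₁ : Function.Bijective f₁ := by
    constructor
    · rw [injective_iff_map_eq_zero]
      rintro ⟨⟨x, y⟩, hu⟩ (rfl : x = 0)
      let N : Subrepresentation ρ₂ :=
        ⟨U.comap (LinearMap.inr R V₁ V₂), fun g y hy => by simpa using hUg g _ hy⟩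
      rcases eq_bot_or_eq_top N with hN | hN
      · obtain rfl : y = 0 := by
          have : y ∈ N.toSubmodule := hu
          rwa [hN] at this
        rfl
      · have : v₂ ∈ N.toSubmodule := hN ▸ Submodule.mem_top
        obtain ⟨c, hc⟩ := hmult (0, v₂) this
          (fun h => Prod.ext (by simp) (hv₂ h))
        have hc₁ : c • v₁ = 0 := congrArg Prod.fst hc
        have hc₂ : c • v₂ = v₂ := congrArg Prod.snd hc
        rw [(smul_eq_zero.1 hc₁).resolve_right hv₁0, zero_smul] at hc₂
        exact absurd hc₂.symm hv₂0
    · let N : Subrepresentation ρ₁ :=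
        ⟨LinearMap.range f₁, by
          rintro g _ ⟨u, rfl⟩
          exact ⟨⟨_, hUg g u u.2⟩, rfl⟩⟩
      rcases eq_bot_or_eq_top N with hN | hN
      · have : v₁ ∈ N.toSubmodule := ⟨⟨_, hUv⟩, rfl⟩
        rw [hN] at this
        exact absurd ((Submodule.mem_bot R).1 this) hv₁0
      · exact LinearMap.range_eq_top.1 (congrArg Subrepresentation.toSubmodule hN)
  have hf₂ : Function.Bijective f₂ := by
    constructor
    · rw [injective_iff_map_eq_zero]
      rintro ⟨⟨x, y⟩, hu⟩ (rfl : y = 0)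
      let N : Subrepresentation ρ₁ :=
        ⟨U.comap (LinearMap.inl R V₁ V₂), fun g x hx => by simpa using hUg g _ hx⟩
      rcases eq_bot_or_eq_top N with hN | hN
      · obtain rfl : x = 0 := by
          have : x ∈ N.toSubmodule := hu
          rwa [hN] at this
        rfl
      · have : v₁ ∈ N.toSubmodule := hN ▸ Submodule.mem_top
        obtain ⟨c, hc⟩ := hmult (v₁, 0) this
          (fun h => Prod.ext (hv₁ h) (by simp))
        have hc₁ : c • v₁ = v₁ := congrArg Prod.fst hc
        have hc₂ : c • v₂ = 0 := congrArg Prod.snd hc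
        rw [(smul_eq_zero.1 hc₂).resolve_right hv₂0, zero_smul] at hc₁
        exact absurd hc₁.symm hv₁0
    · let N : Subrepresentation ρ₂ :=
        ⟨LinearMap.range f₂, by
          rintro g _ ⟨u, rfl⟩
          exact ⟨⟨_, hUg g u u.2⟩, rfl⟩⟩
      rcases eq_bot_or_eq_top N with hN | hN
      · have : v₂ ∈ N.toSubmodule := ⟨⟨_, hUv⟩, rfl⟩
        rw [hN] at this
        exact absurd ((Submodule.mem_bot R).1 this) hv₂0
      · exact LinearMap.range_eq_top.1 (congrArg Subrepresentation.toSubmodule hN)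
  let e₁ := LinearEquiv.ofBijective f₁ hf₁
  let e₂ := LinearEquiv.ofBijective f₂ hf₂
  refine ⟨Representation.Equiv.mk (e₁.symm.trans e₂) fun g => LinearMap.ext fun x => ?_⟩
  obtain ⟨u, rfl⟩ := e₁.surjective x
  have h : ρ₁ g (e₁ u) = e₁ ⟨_, hUg g u u.2⟩ := rfl
  simp only [LinearMap.comp_apply, LinearEquiv.coe_coe, LinearEquiv.trans_apply, h,
    LinearEquiv.symm_apply_apply]
  rfl

end Irreducible

/-! ### Compact induction -/

section General

open scoped Pointwise

variable {R : Type*} [Field R] {G : Type*} [Group G] [TopologicalSpace G]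
  {K : Subgroup G}

theorem isSmoothRep_compactInduction [IsTopologicalGroup G] (χ : K →* Rˣ) : IsSmoothRep (compactInduction χ) := by
  intro f
  obtain ⟨U, hU⟩ := f.2.2.1
  let S : Subgroup G :=
    { carrier := {g | compactInduction χ g f = f}
      mul_mem' := fun {a b} ha hb => by
        rw [Set.mem_ofPred_eq, map_mul, Module.End.mul_apply, show _ = f from hb]
        exact ha
      one_mem' := by simp
      inv_mem' := fun {a} ha => by
        have ha : compactInduction χ a f = f := ha
        rw [Set.mem_ofPred_eq]
        conv_lhs => rw [← ha]
        rw [← Module.End.mul_apply, ← map_mul, inv_mul_cancel, map_one, Module.End.one_apply] }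
  have hUS : (U : Subgroup G) ≤ S := fun u hu => Subtype.ext (funext fun g => hU g u hu)
  exact Subgroup.isOpen_mono hUS U.isOpen

/-- If `χ` is trivial on `K ∩ U` for an open subgroup `U` which is compact modulo `K`, the
function supported on `K U` equal to `k u ↦ χ(k)` is a nonzero element of the compact induction. -/
theorem exists_ne_zero_compactInductionSpace (χ : K →* Rˣ) (U : OpenSubgroup G)
    (hχ : ∀ k : K, (k : G) ∈ U → χ k = 1) {C : Set G} (hC : IsCompact C)
    (hUC : (U : Set G) ⊆ (K : Set G) * C) : ∃ f : compactInductionSpace χ, f ≠ 0 := by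
  classical
  let f : G → R := fun g =>
    if h : ∃ k : K, (k : G)⁻¹ * g ∈ U then ((χ h.choose : Rˣ) : R) else 0
  have hf : ∀ (k : K) (g : G), (k : G)⁻¹ * g ∈ U → f g = ((χ k : Rˣ) : R) := by
    intro k g hk
    have h : ∃ k : K, (k : G)⁻¹ * g ∈ U := ⟨k, hk⟩
    have h1 : χ (k⁻¹ * h.choose) = 1 := by
      refine hχ _ ?_
      have := U.mul_mem hk (U.inv_mem h.choose_spec)
      simpa using this
    rw [map_mul, map_inv, inv_mul_eq_one] at h1
    simp only [f, dif_pos h, h1]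
  have hf0 : ∀ g : G, (¬ ∃ k : K, (k : G)⁻¹ * g ∈ U) → f g = 0 := fun g h => dif_neg h
  refine ⟨⟨f, ?_, ⟨U, ?_⟩, C, hC, ?_⟩, ?_⟩
  · intro k g
    by_cases h : ∃ k : K, (k : G)⁻¹ * g ∈ U
    · obtain ⟨k', hk'⟩ := h
      rw [hf k' g hk', hf (k * k') (k * g) (by simpa [mul_assoc] using hk'), map_mul,
        Units.val_mul]
    · rw [hf0 g h, mul_zero]
      refine hf0 _ ?_
      rintro ⟨k', hk'⟩
      exact h ⟨k⁻¹ * k', by simpa [mul_assoc] using hk'⟩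
  · intro g u hu
    by_cases h : ∃ k : K, (k : G)⁻¹ * g ∈ U
    · obtain ⟨k, hk⟩ := h
      rw [hf k g hk, hf k (g * u) (by simpa [mul_assoc] using U.mul_mem hk hu)]
    · rw [hf0 g h]
      refine hf0 _ ?_
      rintro ⟨k, hk⟩
      exact h ⟨k, by simpa [mul_assoc] using U.mul_mem hk (U.inv_mem hu)⟩
  · intro g hg
    obtain ⟨k, hk⟩ := not_not.1 (mt (hf0 g) hg)
    obtain ⟨k', hk', c, hc, hkc⟩ := Set.mem_mul.1 (hUC hk)
    exact Set.mem_mul.2 ⟨k * k', K.mul_mem k.2 hk', c, hc, by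
      rw [mul_assoc, hkc, mul_inv_cancel_left]⟩
  · intro h
    have h1 : f 1 = 0 := congrFun (congrArg Subtype.val h) 1
    rw [hf 1 1 (by simp), map_one, Units.val_one] at h1
    exact one_ne_zero h1

end General

section Induction

variable {F : Type*} [Field F] [TopologicalSpace F]
  {W : Type*} [AddCommGroup W] [Module F W] [TopologicalSpace W]
  {R : Type*} [Field R] {ψ : AddChar F Rˣ} {B : LinearMap.BilinForm F W} {p : ℕ}
  {A Λ : AddSubgroup W} {χA : preimage B A →* Rˣ} {χ : preimage B Λ →* Rˣ}

theorem compactInduction_central_apply (hχA : IsSmoothExtension ψ B A χA)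
    (f : compactInductionSpace χA) (g : Heisenberg B) (t : F) :
    f.1 (g * ⟨0, t⟩) = ((ψ t : Rˣ) : R) * f.1 g := by
  have h : g * ⟨0, t⟩ = (central B A t : Heisenberg B) * g := by
    ext <;> simp [central, add_comm]
  rw [h, f.2.1, hχA.2]

variable [IsTopologicalRing F] [IsModuleTopology F W] [FiniteDimensional F W]

variable (B) in
theorem exists_nhds_psi_half_eq_one (hψ : IsLocallyConstant ψ) :
    ∃ U ∈ nhds (0 : W), ∀ x ∈ U, ∀ y ∈ U, ψ (B x y / 2) = 1 := by
  have hc : Continuous fun x : W × W => B x.1 x.2 / 2 := by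
    simp only [div_eq_mul_inv]
    exact (IsModuleTopology.continuous_bilinear_of_finite_left B).mul continuous_const
  have h : {x : W × W | ψ (B x.1 x.2 / 2) = 1} ∈ nhds ((0 : W), (0 : W)) :=
    ((hψ.isOpen_fiber 1).preimage hc).mem_nhds (by simp)
  obtain ⟨U, hU, V, hV, hUV⟩ := mem_nhds_prod_iff.1 h
  exact ⟨U ∩ V, Filter.inter_mem hU hV, fun x hx y hy =>
    hUV (Set.mk_mem_prod hx.1 hy.2)⟩

theorem isSmoothPsiRep_compactInduction (hχA : IsSmoothExtension ψ B A χA) :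
    IsSmoothPsiRep B ψ (compactInduction χA) where
  smooth := isSmoothRep_compactInduction χA
  central t f := Subtype.ext (funext fun g => compactInduction_central_apply hχA f g t)

theorem nontrivial_compactInductionSpace (hΛ : IsGoodLattice ψ B Λ)
    (hψ : IsLocallyConstant ψ) (hχA : IsSmoothExtension ψ B A χA) :
    Nontrivial (compactInductionSpace χA) := by
  have : IsTopologicalAddGroup W := IsModuleTopology.topologicalAddGroup F W
  obtain ⟨U₁, hU₁, hU₁'⟩ := exists_nhds_psi_half_eq_one B hψ
  obtain ⟨U₂, hU₂, hU₂'⟩ := hχA.exists_nhds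
  obtain ⟨L, hLΛ, hLU, hLo, -, -⟩ := hΛ.exists_le _ (Filter.inter_mem hU₁ hU₂)
  have hLcl : IsClosed (L : Set W) := L.isClosed_of_isOpen hLo
  have hLc : IsCompact (L : Set W) := hΛ.isCompact.of_isClosed_subset hLcl hLΛ
  have hc : Continuous fun g : Heisenberg B => (g.vec, g.scalar) := continuous_induced_dom
  let U : OpenSubgroup (Heisenberg B) :=
    { carrier := {g | g.vec ∈ L ∧ ψ g.scalar = 1}
      mul_mem' := fun {g h} hg hh => ⟨L.add_mem hg.1 hh.1, by
        rw [mul_scalar, AddChar.map_add_eq_mul, AddChar.map_add_eq_mul, hg.2, hh.2,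
          hU₁' _ (hLU hg.1).1 _ (hLU hh.1).1, one_mul, one_mul]⟩
      one_mem' := ⟨L.zero_mem, by simp⟩
      inv_mem' := fun {g} hg => ⟨L.neg_mem hg.1, by
        rw [inv_scalar, AddChar.map_add_eq_mul, AddChar.map_neg_eq_inv, hg.2,
          hU₁' _ (hLU hg.1).1 _ (hLU hg.1).1, inv_one, one_mul]⟩
      isOpen' := (hLo.prod (hψ.isOpen_fiber 1)).preimage hc }
  obtain ⟨f, hf⟩ := exists_ne_zero_compactInductionSpace χA U
    (by
      rintro k ⟨hk, hk'⟩
      rw [eq_ofVec_mul_central k, map_mul, hχA.2, hk', mul_one]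
      exact hU₂' _ (hLU hk).2)
    (hLc.image (continuous_ofVec (B := B) 0))
    (fun g hg => Set.mem_mul.2 ⟨⟨0, g.scalar⟩, A.zero_mem, ⟨g.vec, 0⟩, ⟨g.vec, hg.1, rfl⟩, by
      ext <;> simp⟩)
  exact ⟨f, 0, hf⟩

theorem apply_mul_ofVec_of_mem_conjEigenspace {f : compactInductionSpace χA}
    (hf : f ∈ conjEigenspace ψ (compactInduction χA) χ 0) (g : Heisenberg B) (l : Λ) :
    f.1 (g * ⟨l, 0⟩) = ((χ (ofVec B Λ l) : Rˣ) : R) * f.1 g := by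
  have h : f.1 (g * ⟨l, 0⟩) =
      ((χ (ofVec B Λ l) * ψ (B (l : W) 0) : Rˣ) : R) * f.1 g :=
    congrFun (congrArg Subtype.val (hf (ofVec B Λ l))) g
  rwa [map_zero, AddChar.map_zero_eq_one, mul_one] at h

/-- If an eigenvector does not vanish at `g`, then `ψ_A` conjugated by `g` agrees with `χ` on
`A ∩ Λ`. -/
theorem psi_mul_eq_of_ne_zero (hB : B.IsAlt) (h2 : (2 : F) ≠ 0)
    (hχA : IsSmoothExtension ψ B A χA) {f : compactInductionSpace χA}
    (hf : f ∈ conjEigenspace ψ (compactInduction χA) χ 0) {g : Heisenberg B} (hg : f.1 g ≠ 0)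
    {a : W} (haA : a ∈ A) (haΛ : a ∈ Λ) :
    χA (ofVec B A ⟨a, haA⟩) * ψ (B g.vec a) = χ (ofVec B Λ ⟨a, haΛ⟩) := by
  have h3 : f.1 (g * ⟨a, 0⟩) =
      ((ψ (B g.vec a) : Rˣ) : R) * (((χA (ofVec B A ⟨a, haA⟩) : Rˣ) : R) * f.1 g) := by
    rw [mul_comm_of_isAlt hB h2, compactInduction_central_apply hχA]
    exact congrArg _ (f.2.1 (ofVec B A ⟨a, haA⟩) g)
  have h4 := (apply_mul_ofVec_of_mem_conjEigenspace hf g ⟨a, haΛ⟩).symm.trans h3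
  rw [← mul_assoc] at h4
  apply Units.ext
  rw [Units.val_mul, mul_comm]
  exact (mul_right_cancel₀ hg h4).symm

/-- An eigenvector is determined on the double coset of `g` by its value at `g`. -/
theorem eq_zero_of_vec_sub_mem (hχA : IsSmoothExtension ψ B A χA) {f : compactInductionSpace χA}
    (hf : f ∈ conjEigenspace ψ (compactInduction χA) χ 0) {g g' : Heisenberg B}
    (hgg' : g'.vec - g.vec ∈ A ⊔ Λ) (hg : f.1 g = 0) : f.1 g' = 0 := by
  obtain ⟨a, ha, l, hl, hal⟩ := AddSubgroup.mem_sup.1 hgg'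
  let x : Heisenberg B := ⟨a, 0⟩ * g * ⟨l, 0⟩
  have hx : g' = x * ⟨0, g'.scalar - x.scalar⟩ := by
    ext
    · have : g'.vec = a + g.vec + l := by rw [add_right_comm, hal, sub_add_cancel]
      simp [x, this]
    · simp
  have h1 := apply_mul_ofVec_of_mem_conjEigenspace hf (⟨a, 0⟩ * g) ⟨l, hl⟩
  have h2 : f.1 (⟨a, 0⟩ * g) = ((χA (ofVec B A ⟨a, ha⟩) : Rˣ) : R) * f.1 g :=
    f.2.1 (ofVec B A ⟨a, ha⟩) g
  rw [hx, compactInduction_central_apply hχA, h1, h2, hg, mul_zero, mul_zero, mul_zero]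

/-- The character `χ` of `Λ × F` has multiplicity at most one in the compact induction of `ψ_A`,
since `(A ∩ Λ)^⊥ = A + Λ`. -/
theorem exists_conjEigenspace_le_span (hΛ : IsGoodLattice ψ B Λ) (hB : B.IsAlt)
    (h2 : (2 : F) ≠ 0) (hψ : IsLocallyConstant ψ) (hp : p.Prime)
    (hpF : IsTopologicallyNilpotent (p : F)) (hR : ringChar R ≠ p)
    (hA : IsSelfDual ψ B A) (hχA : IsSmoothExtension ψ B A χA) :
    ∃ f₀, conjEigenspace ψ (compactInduction χA) χ 0 ≤ Submodule.span R {f₀} := by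
  by_cases hbot : conjEigenspace ψ (compactInduction χA) χ 0 = ⊥
  · exact ⟨0, by rw [hbot]; exact bot_le⟩
  obtain ⟨f₀, hf₀, hf₀0⟩ := Submodule.exists_mem_ne_zero_of_ne_bot hbot
  obtain ⟨g, hg⟩ : ∃ g, f₀.1 g ≠ 0 := by
    by_contra! h
    exact hf₀0 (Subtype.ext (funext h))
  refine ⟨f₀, fun f hf => Submodule.mem_span_singleton.2 ⟨f.1 g / f₀.1 g, ?_⟩⟩
  have hd : f - (f.1 g / f₀.1 g) • f₀ ∈ conjEigenspace ψ (compactInduction χA) χ 0 :=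
    Submodule.sub_mem _ hf (Submodule.smul_mem _ _ hf₀)
  have hdg : (f - (f.1 g / f₀.1 g) • f₀).1 g = 0 := by
    change f.1 g - f.1 g / f₀.1 g * f₀.1 g = 0
    rw [div_mul_cancel₀ _ hg, sub_self]
  rw [eq_comm, ← sub_eq_zero]
  refine Subtype.ext (funext fun g' => ?_)
  by_contra hg'
  refine hg' (eq_zero_of_vec_sub_mem hχA hd (hΛ.psiOrthogonal_inf_le hB hψ hp hpF hR hA ?_) hdg)
  rintro a ⟨haA, haΛ⟩
  have h3 := psi_mul_eq_of_ne_zero hB h2 hχA hf₀ hg haA haΛ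
  have h4 := psi_mul_eq_of_ne_zero hB h2 hχA hd hg' haA haΛ
  rw [map_sub, LinearMap.sub_apply, AddChar.map_sub_eq_div, div_eq_one]
  exact mul_left_cancel (h4.trans h3.symm)

theorem isHeisenbergRep_compactInduction (hΛ : IsGoodLattice ψ B Λ) (hB : B.IsAlt)
    (h2 : (2 : F) ≠ 0) (hψ : IsLocallyConstant ψ) (hp : p.Prime)
    (hpF : IsTopologicallyNilpotent (p : F)) (hR : ringChar R ≠ p)
    (hχ : IsSmoothExtension ψ B Λ χ)
    (hA : IsSelfDual ψ B A) (hχA : IsSmoothExtension ψ B A χA) :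
    IsHeisenbergRep B ψ (compactInduction χA) := by
  have hρ := isSmoothPsiRep_compactInduction hχA
  have := nontrivial_compactInductionSpace hΛ hψ hχA
  obtain ⟨f₀, hf₀⟩ := exists_conjEigenspace_le_span (χ := χ) hΛ hB h2 hψ hp hpF hR hA hχA
  exact ⟨hρ.smooth, isIrreducible_of_conjEigenspace_le hΛ hB h2 hp hpF hR hχ hρ hf₀, hρ.central⟩

end Induction

/-! ### Extending `ψ` to `A × F` -/

theorem MonoidHom.isLocallyConstant_of_mem_nhds {G M : Type*} [Group G] [TopologicalSpace G]
    [IsTopologicalGroup G] [Group M] (f : G →* M) (hf : {g | f g = 1} ∈ nhds (1 : G)) :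
    IsLocallyConstant f := by
  refine (IsLocallyConstant.iff_eventually_eq f).2 fun x => ?_
  have hc : Filter.Tendsto (fun y => x⁻¹ * y) (nhds x) (nhds 1) := by
    have := (continuous_const_mul x⁻¹).tendsto x
    rwa [inv_mul_cancel] at this
  filter_upwards [hc hf] with y hy
  have : f (x⁻¹ * y) = 1 := hy
  rw [map_mul, map_inv, inv_mul_eq_one] at this
  exact this.symm

/-- A homomorphism from a subgroup `S` of a group `G` to an abelian group which is divisible
extends to `G` if it is trivial on the commutators of `G` that lie in `S`. -/
theorem exists_monoidHom_extension {G M : Type*} [Group G] [CommGroup M]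
    (hdiv : ∀ n : ℕ, n ≠ 0 → ∀ x : M, ∃ y, y ^ n = x) (S : Subgroup G) (f : S →* M)
    (hf : ∀ s : S, (s : G) ∈ commutator G → f s = 1) :
    ∃ f' : G →* M, ∀ s : S, f' s = f s := by
  let : DivisibleBy (Additive M) ℕ := divisibleByOfSMulRightSurj _ _
    fun {n} hn x => hdiv n hn x
  let : DivisibleBy (Additive M) ℤ := AddGroup.divisibleByIntOfDivisibleByNat _
  let T : S →* Abelianization G := Abelianization.of.comp S.subtype
  let φ : T.range →* M := MonoidHom.liftOfSurjective T.rangeRestrict T.rangeRestrict_surjective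
    ⟨f, fun s hs => hf s (by
      rw [← Abelianization.ker_of]
      exact congrArg Subtype.val hs)⟩
  obtain ⟨h, hh⟩ := Module.Baer.extension_property_addMonoidHom
    (Module.Baer.of_divisible (Additive M)) (MonoidHom.toAdditive T.range.subtype)
    Subtype.val_injective (MonoidHom.toAdditive φ)
  refine ⟨(MonoidHom.toAdditive.symm h).comp Abelianization.of, fun s => ?_⟩
  have h1 : (h (Additive.ofMul (T s))).toMul = φ (T.rangeRestrict s) :=
    congrArg Additive.toMul (DFunLike.congr_fun hh (Additive.ofMul (T.rangeRestrict s)))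
  have h2 : φ (T.rangeRestrict s) = f s :=
    MonoidHom.liftOfRightInverse_comp_apply _ _ _ _ _
  exact h1.trans h2

section Extension

variable {F : Type*} [Field F] [TopologicalSpace F]
  {W : Type*} [AddCommGroup W] [Module F W] [TopologicalSpace W]
  {R : Type*} [Field R] {ψ : AddChar F Rˣ} {B : LinearMap.BilinForm F W} {p : ℕ}
  {A Λ : AddSubgroup W}

/-- If `ψ(⟨a, a'⟩ / 2) = 1` on `A`, then `(a, t) ↦ ψ(t)` is a character of `A × F`. -/
theorem exists_extension_of_psi_half_eq_one (hψ : IsLocallyConstant ψ)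
    (hA : ∀ a ∈ A, ∀ a' ∈ A, ψ (B a a' / 2) = 1) :
    ∃ χ : preimage B A →* Rˣ, IsSmoothExtension ψ B A χ ∧
      ∀ h, χ h = ψ (h : Heisenberg B).scalar := by
  have hc : Continuous fun g : Heisenberg B => (g.vec, g.scalar) := continuous_induced_dom
  refine ⟨{ toFun := fun h => ψ (h : Heisenberg B).scalar
            map_one' := by simp
            map_mul' := fun x y => ?_ }, ⟨?_, fun t => rfl⟩, fun h => rfl⟩
  · rw [Subgroup.coe_mul, mul_scalar, AddChar.map_add_eq_mul, AddChar.map_add_eq_mul,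
      hA _ x.2 _ y.2, mul_one]
  · exact hψ.comp_continuous ((continuous_snd.comp hc).comp continuous_subtype_val)

theorem psi_half_eq_one_of_odd [IsTopologicalRing F] (hp : p.Prime) (hp2 : p ≠ 2)
    (h2 : (2 : F) ≠ 0) (hpF : IsTopologicallyNilpotent (p : F)) (hψ : IsLocallyConstant ψ)
    {x : F} (hx : ψ x = 1) : ψ (x / 2) = 1 := by
  obtain ⟨n, hn⟩ := exists_pow_psi_eq_one hpF hψ (x / 2)
  have h : ψ (x / 2) ^ 2 = 1 := by
    rw [← AddChar.map_nsmul_eq_pow, nsmul_eq_mul, Nat.cast_two, mul_div_cancel₀ _ h2, hx]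
  have hcop : Nat.Coprime 2 (p ^ n) :=
    ((Nat.coprime_primes Nat.prime_two hp).2 hp2.symm).pow_right n
  rw [← orderOf_eq_one_iff]
  exact Nat.eq_one_of_dvd_coprimes hcop (orderOf_dvd_of_pow_eq_one h)
    (orderOf_dvd_of_pow_eq_one hn)

/-- In characteristic zero the image of `ψ` is divisible. The extension is prescribed by
`(m, t) ↦ ψ(t)` on `(A ∩ M) × F` for a small open subgroup `M`, which makes it smooth. -/
theorem exists_extension_of_charZero [CharZero F] [IsTopologicalRing F] [IsModuleTopology F W]
    [FiniteDimensional F W] (hΛ : IsGoodLattice ψ B Λ) (hB : B.IsAlt)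
    (h2 : (2 : F) ≠ 0) (hψ : IsLocallyConstant ψ) (hA : IsSelfDual ψ B A) :
    ∃ χ : preimage B A →* Rˣ, IsSmoothExtension ψ B A χ := by
  have hc : Continuous fun g : Heisenberg B => (g.vec, g.scalar) := continuous_induced_dom
  obtain ⟨U, hU, hU'⟩ := exists_nhds_psi_half_eq_one (ψ := ψ) B hψ
  obtain ⟨M, -, hMU, hMo, -, -⟩ := hΛ.exists_le _ hU
  obtain ⟨χ₀, -, hχ₀⟩ := exists_extension_of_psi_half_eq_one (B := B) (A := M) hψ
    fun a ha a' ha' => hU' a (hMU ha) a' (hMU ha')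
  let D : Subgroup Rˣ := ψ.toMonoidHom.range
  have hdiv : ∀ n : ℕ, n ≠ 0 → ∀ x : D, ∃ y, y ^ n = x := by
    rintro n hn ⟨_, x, rfl⟩
    refine ⟨⟨_, Multiplicative.ofAdd (x.toAdd / n), rfl⟩, Subtype.ext ?_⟩
    change ψ (x.toAdd / n) ^ n = ψ x.toAdd
    rw [← AddChar.map_nsmul_eq_pow, nsmul_eq_mul, mul_div_cancel₀ _ (Nat.cast_ne_zero.2 hn)]
  let S : Subgroup (preimage B A) := (preimage B M).subgroupOf (preimage B A)
  let f : S →* D := (χ₀.comp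
    { toFun := fun s : S => ⟨(s : preimage B A), s.2⟩, map_one' := rfl, map_mul' := fun _ _ => rfl }).codRestrict D
      fun s => ⟨Multiplicative.ofAdd ((s : preimage B A) : Heisenberg B).scalar,
        (hχ₀ ⟨((s : preimage B A) : Heisenberg B), s.2⟩).symm⟩
  have hf : ∀ s : S, ((f s : D) : Rˣ) = ψ ((s : preimage B A) : Heisenberg B).scalar := fun s => hχ₀ _
  let N : Subgroup (preimage B A) :=
    { carrier := {h | (h : Heisenberg B).vec = 0 ∧ ψ (h : Heisenberg B).scalar = 1}
      mul_mem' := fun {x y} hx hy => by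
        refine ⟨?_, ?_⟩
        · rw [Subgroup.coe_mul, mul_vec, hx.1, hy.1, add_zero]
        · rw [Subgroup.coe_mul, mul_scalar, hx.1, AddChar.map_add_eq_mul,
            AddChar.map_add_eq_mul, hx.2, hy.2]
          simp
      one_mem' := by simp
      inv_mem' := fun {x} hx => by
        refine ⟨?_, ?_⟩
        · rw [Subgroup.coe_inv, inv_vec, hx.1, neg_zero]
        · rw [Subgroup.coe_inv, inv_scalar, hx.1, AddChar.map_add_eq_mul,
            AddChar.map_neg_eq_inv, hx.2]
          simp }
  have hN : commutator (preimage B A) ≤ N := by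
    refine Subgroup.commutator_le.2 fun x _ y _ => ?_
    have h : x * y * x⁻¹ * y⁻¹ = central B A (B (x : Heisenberg B).vec (y : Heisenberg B).vec) := by
      rw [mul_inv_eq_iff_eq_mul, mul_inv_eq_iff_eq_mul]
      refine Subtype.ext ?_
      change (x : Heisenberg B) * y = ⟨0, _⟩ * y * x
      rw [mul_comm_of_isAlt hB h2 (y : Heisenberg B) x]
      ext
      · simp [add_comm]
      · simp only [mul_scalar, mul_vec, map_zero, LinearMap.zero_apply, zero_div, add_zero,
          zero_add]
        ring
    rw [commutatorElement_def, h]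
    exact ⟨rfl, hA.mem_iff.1 x.2 _ y.2⟩
  obtain ⟨f', hf'⟩ := exists_monoidHom_extension hdiv S f
    fun s hs => Subtype.ext ((hf s).trans (hN hs).2)
  have hχ : ∀ s : S, ((f' s : D) : Rˣ) = ψ ((s : preimage B A) : Heisenberg B).scalar := fun s => by
    rw [hf', hf]
  refine ⟨D.subtype.comp f', MonoidHom.isLocallyConstant_of_mem_nhds _ ?_,
    fun t => hχ ⟨central B A t, M.zero_mem⟩⟩
  have hopen : IsOpen {h : preimage B A | (h : Heisenberg B).vec ∈ M ∧
      ψ (h : Heisenberg B).scalar = 1} :=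
    (hMo.prod (hψ.isOpen_fiber 1)).preimage (hc.comp continuous_subtype_val)
  refine Filter.mem_of_superset (hopen.mem_nhds ⟨M.zero_mem, by simp⟩) ?_
  rintro h ⟨hM, hψh⟩
  exact (hχ ⟨h, hM⟩).trans hψh

end Extension

/-! ### Symplectic bases and Lagrangians -/

section Symplectic

variable {F : Type*} [Field F] {W : Type*} [AddCommGroup W] [Module F W]
  {B : LinearMap.BilinForm F W}

/-- The vectors `e i`, `f i` satisfy the relations of a symplectic basis:
`⟨e i, e j⟩ = ⟨f i, f j⟩ = 0` and `⟨e i, f j⟩ = δ i j`. -/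
structure IsSymplecticFamily {ι : Type*} [DecidableEq ι] (B : LinearMap.BilinForm F W)
    (e f : ι → W) : Prop where
  left : ∀ i j, B (e i) (e j) = 0
  right : ∀ i j, B (f i) (f j) = 0
  pairing : ∀ i j, B (e i) (f j) = if i = j then 1 else 0

namespace IsSymplecticFamily

variable {ι : Type*} [DecidableEq ι] {e f : ι → W}

theorem pairing_swap (h : IsSymplecticFamily B e f) (hB : B.IsAlt) (i j : ι) :
    B (f i) (e j) = if i = j then -1 else 0 := by
  rw [← hB.neg_eq, h.pairing]
  simp only [eq_comm (a := j)]
  split_ifs <;> simp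

variable [Fintype ι]

theorem linearIndependent (h : IsSymplecticFamily B e f) (hB : B.IsAlt) :
    LinearIndependent F (Sum.elim e f) := by
  rw [Fintype.linearIndependent_iff]
  intro c hc
  rw [Fintype.sum_sum_type] at hc
  simp only [Sum.elim_inl, Sum.elim_inr] at hc
  rintro (i | i)
  · have := congrArg (fun w => B w (f i)) hc
    simpa [h.pairing, h.right] using this
  · have := congrArg (fun w => B w (e i)) hc
    simpa [h.pairing_swap hB, h.left] using this

/-- Modulo the span of a symplectic family, every vector is orthogonal to that family. -/
theorem exists_projection (h : IsSymplecticFamily B e f) (hB : B.IsAlt) (w : W) :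
    ∃ w', w - w' ∈ Submodule.span F (Set.range (Sum.elim e f)) ∧
      (∀ i, B w' (e i) = 0) ∧ ∀ i, B w' (f i) = 0 := by
  refine ⟨w - (∑ i, B w (f i) • e i - ∑ i, B w (e i) • f i), ?_, fun j => ?_, fun j => ?_⟩
  · rw [sub_sub_cancel]
    refine Submodule.sub_mem _ (Submodule.sum_mem _ fun i _ => ?_)
      (Submodule.sum_mem _ fun i _ => ?_)
    · exact Submodule.smul_mem _ _ (Submodule.subset_span ⟨Sum.inl i, rfl⟩)
    · exact Submodule.smul_mem _ _ (Submodule.subset_span ⟨Sum.inr i, rfl⟩)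
  · simp [h.left, h.pairing_swap hB]
  · simp [h.pairing, h.right]

end IsSymplecticFamily

theorem IsSymplecticFamily.apply_inr {ι : Type*} [DecidableEq ι] [Fintype ι]
    {b : Module.Basis (ι ⊕ ι) F W}
    (h : IsSymplecticFamily B (fun i => b (Sum.inl i)) (fun i => b (Sum.inr i))) (w : W) (j : ι) :
    B w (b (Sum.inr j)) = b.repr w (Sum.inl j) := by
  conv_lhs => rw [← b.sum_repr w, Fintype.sum_sum_type]
  simp [h.pairing, h.right]

theorem IsSymplecticFamily.apply_inl {ι : Type*} [DecidableEq ι] [Fintype ι]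
    {b : Module.Basis (ι ⊕ ι) F W} (hB : B.IsAlt)
    (h : IsSymplecticFamily B (fun i => b (Sum.inl i)) (fun i => b (Sum.inr i))) (w : W) (j : ι) :
    B w (b (Sum.inl j)) = -b.repr w (Sum.inr j) := by
  conv_lhs => rw [← b.sum_repr w, Fintype.sum_sum_type]
  simp [h.pairing_swap hB, h.left]

/-- A maximal symplectic family spans: otherwise a nonzero vector orthogonal to it, together with
a vector dual to that one, would enlarge the family. -/
theorem exists_symplectic_basis [FiniteDimensional F W] (hB : B.IsAlt) (hBnd : B.Nondegenerate) :
    ∃ (n : ℕ) (b : Module.Basis (Fin n ⊕ Fin n) F W),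
      IsSymplecticFamily B (fun i => b (Sum.inl i)) (fun i => b (Sum.inr i)) := by
  classical
  let P : ℕ → Prop := fun n => ∃ e f : Fin n → W, IsSymplecticFamily B e f
  have h0 : P 0 := ⟨Fin.elim0, Fin.elim0, ⟨fun i => i.elim0, fun i => i.elim0, fun i => i.elim0⟩⟩
  have hle : ∀ n, P n → n ≤ Module.finrank F W := by
    rintro n ⟨e, f, h⟩
    have := (h.linearIndependent hB).fintype_card_le_finrank
    simp only [Fintype.card_sum, Fintype.card_fin] at this
    omega
  have hmax : P (Nat.findGreatest P (Module.finrank F W)) :=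
    Nat.findGreatest_spec (Nat.zero_le _) h0
  have hmax' : ¬ P (Nat.findGreatest P (Module.finrank F W) + 1) := fun h => by
    have := Nat.le_findGreatest (hle _ h) h
    omega
  generalize Nat.findGreatest P (Module.finrank F W) = n at hmax hmax'
  obtain ⟨e, f, h⟩ := hmax
  have hspan : ⊤ ≤ Submodule.span F (Set.range (Sum.elim e f)) := by
    intro w _
    obtain ⟨w', hw, hwe, hwf⟩ := h.exists_projection hB w
    by_cases hw' : w' = 0
    · rwa [hw', sub_zero] at hw
    · exfalso
      obtain ⟨u, hu⟩ : ∃ u, B w' u ≠ 0 := by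
        by_contra! hcon
        exact hw' (hBnd.1 w' hcon)
      obtain ⟨u', hu', hue, huf⟩ := h.exists_projection hB u
      have hker : Submodule.span F (Set.range (Sum.elim e f)) ≤ LinearMap.ker (B w') := by
        rw [Submodule.span_le]
        rintro _ ⟨i | i, rfl⟩
        · exact hwe i
        · exact hwf i
      have huu' : B w' u' = B w' u := by
        have := hker hu'
        rw [LinearMap.mem_ker, map_sub, sub_eq_zero] at this
        exact this.symm
      have hswap : ∀ x y, B x y = 0 → B y x = 0 := fun x y hxy => by
        rw [← hB.neg_eq, hxy, neg_zero]
      refine hmax' ⟨Fin.cons w' e, Fin.cons ((B w' u)⁻¹ • u') f, ⟨?_, ?_, ?_⟩⟩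
      · refine Fin.cases (Fin.cases ?_ fun j => ?_) fun i => Fin.cases ?_ fun j => ?_
        · exact hB w'
        · exact hwe j
        · exact hswap _ _ (hwe i)
        · exact h.left i j
      · refine Fin.cases (Fin.cases ?_ fun j => ?_) fun i => Fin.cases ?_ fun j => ?_
        · exact hB _
        · simp [huf j]
        · simp [hswap _ _ (huf i)]
        · exact h.right i j
      · refine Fin.cases (Fin.cases ?_ fun j => ?_) fun i => Fin.cases ?_ fun j => ?_
        · simp [huu', hu]
        · simp [hwf j, (Fin.succ_ne_zero j).symm]
        · simp [hswap _ _ (hue i), Fin.succ_ne_zero i]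
        · simp [h.pairing i j]
  refine ⟨n, Module.Basis.mk (h.linearIndependent hB) hspan, ?_⟩
  simpa using h

theorem exists_isLagrangian [FiniteDimensional F W] (hB : B.IsAlt) (hBnd : B.Nondegenerate) :
    ∃ X : Submodule F W, IsLagrangian B X := by
  obtain ⟨n, b, hb⟩ := exists_symplectic_basis hB hBnd
  refine ⟨Submodule.span F (Set.range fun i => b (Sum.inl i)), ?_, ?_⟩
  · intro x hx y hy
    induction hx, hy using Submodule.span_induction₂ with
    | mem_mem x y hx hy =>
      obtain ⟨i, rfl⟩ := hx
      obtain ⟨j, rfl⟩ := hy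
      exact hb.left i j
    | zero_left y hy => simp
    | zero_right x hx => simp
    | add_left x y z _ _ _ hx hy => simp [hx, hy]
    | add_right x y z _ _ _ hx hy => simp [hx, hy]
    | smul_left r x y _ _ h => simp [h]
    | smul_right r x y _ _ h => simp [h]
  · have hli : LinearIndependent F fun i => b (Sum.inl i) :=
      b.linearIndependent.comp _ Sum.inl_injective
    rw [finrank_span_eq_card hli,
      Module.finrank_eq_card_basis b]
    simp [two_mul]

variable {R : Type*} [Field R] {ψ : AddChar F Rˣ}

theorem eq_zero_of_forall_psi_mul_eq_one (hψ1 : ψ ≠ 1) {x : F} (hx : ∀ t, ψ (t * x) = 1) :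
    x = 0 := by
  by_contra hx0
  refine hψ1 (DFunLike.ext _ _ fun t => ?_)
  have := hx (t / x)
  rwa [div_mul_cancel₀ _ hx0] at this

theorem psiOrthogonal_top (hBnd : B.Nondegenerate) (hψ1 : ψ ≠ 1) :
    psiOrthogonal ψ B ⊤ = ⊥ := by
  refine (AddSubgroup.eq_bot_iff_forall _).2 fun w hw => hBnd.1 w fun y => ?_
  refine eq_zero_of_forall_psi_mul_eq_one hψ1 fun t => ?_
  have := hw (t • y) (AddSubgroup.mem_top _)
  rwa [map_smul, smul_eq_mul] at this

theorem IsLagrangian.isSelfDual [FiniteDimensional F W] (hB : B.IsAlt) (hBnd : B.Nondegenerate)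
    (hψ1 : ψ ≠ 1) {X : Submodule F W} (hX : IsLagrangian B X) :
    IsSelfDual ψ B X.toAddSubgroup := by
  have hle : X ≤ B.orthogonal X := fun x hx y hy => hX.1 y hy x hx
  have heq : X = B.orthogonal X := by
    refine Submodule.eq_of_le_of_finrank_eq hle ?_
    rw [LinearMap.BilinForm.finrank_orthogonal hBnd, ← hX.2]
    omega
  refine le_antisymm (fun x hx y hy => ?_) fun w hw => ?_
  · rw [hX.1 x hx y hy, AddChar.map_zero_eq_one]
  · change w ∈ X
    rw [heq]
    intro y hy
    change B y w = 0
    rw [← hB.neg_eq, neg_eq_zero]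
    refine eq_zero_of_forall_psi_mul_eq_one hψ1 fun t => ?_
    have := hw (t • y) (X.smul_mem t hy)
    rwa [map_smul, smul_eq_mul] at this

theorem IsLagrangian.isGoodLattice [TopologicalSpace F] [DiscreteTopology F] [Finite F]
    [FiniteDimensional F W] [TopologicalSpace W] [IsModuleTopology F W]
    (hB : B.IsAlt) (hBnd : B.Nondegenerate)
    (hψ1 : ψ ≠ 1) {X : Submodule F W} (hX : IsLagrangian B X) :
    IsGoodLattice ψ B X.toAddSubgroup := by
  have : IsTopologicalAddGroup W := IsModuleTopology.topologicalAddGroup F W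
  have : Finite W := Module.finite_of_finite F
  have : DiscreteTopology W := by
    have hc : Continuous (Module.finBasis F W).equivFun :=
      IsModuleTopology.continuous_of_linearMap (Module.finBasis F W).equivFun.toLinearMap
    exact DiscreteTopology.of_continuous_injective hc (LinearEquiv.injective _)
  exact
    { selfDual := hX.isSelfDual hB hBnd hψ1
      isOpen := isOpen_discrete _
      isCompact := (Set.toFinite _).isCompact
      exists_le := fun U hU => by
        refine ⟨⊥, bot_le, ?_, isOpen_discrete _, (Set.toFinite _).isCompact, ?_⟩
        · rintro _ rfl
          exact mem_of_mem_nhds hU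
        · have h : psiOrthogonal ψ B ⊥ = ⊤ := by
            refine eq_top_iff.2 fun w _ x hx => ?_
            rw [AddSubgroup.mem_bot.1 hx, map_zero, AddChar.map_zero_eq_one]
          rw [h, psiOrthogonal_top hBnd hψ1] }

end Symplectic

/-! ### Self-dual lattices over local fields -/

section Local

open ValuativeRel

variable {F : Type*} [Field F] [TopologicalSpace F] [ValuativeRel F]
  [IsNonarchimedeanLocalField F]

theorem isTopologicallyNilpotent_of_valuation_lt_one {x : F} (hx : valuation F x < 1) :
    IsTopologicallyNilpotent x := by
  have : MulArchimedean (ValueGroupWithZero F) := isRankLeOne_iff_mulArchimedean.1 inferInstance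
  refine ((IsValuativeTopology.hasBasis_nhds_zero' F).tendsto_right_iff).2 fun γ hγ => ?_
  obtain ⟨n, hn⟩ := exists_pow_lt₀ hx (Units.mk0 γ hγ)
  filter_upwards [Filter.eventually_ge_atTop n] with m hm
  rw [map_pow]
  exact (pow_le_pow_right_of_le_one' hx.le hm).trans_lt hn

theorem valuation_natCast_lt_one (p : ℕ) [CharP 𝓀[F] p] : valuation F (p : F) < 1 := by
  have hle : valuation F (p : F) ≤ 1 := natCast_mem 𝒪[F] p
  refine hle.lt_of_ne fun h1 => ?_
  have hp0 : IsLocalRing.residue 𝒪[F] (p : 𝒪[F]) = 0 := by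
    rw [map_natCast, CharP.cast_eq_zero]
  rw [IsLocalRing.residue_eq_zero_iff] at hp0
  have hne : (p : F) ≠ 0 := by
    intro h
    rw [h, map_zero] at h1
    exact zero_ne_one h1
  refine (IsLocalRing.mem_maximalIdeal _).1 hp0
    (IsUnit.of_mul_eq_one ⟨(p : F)⁻¹, by
      change valuation F (p : F)⁻¹ ≤ 1
      rw [map_inv₀, h1, inv_one]⟩ (Subtype.ext ?_))
  simp [hne]

theorem charZero_of_charP_residueField_two (h2 : (2 : F) ≠ 0) [CharP 𝓀[F] 2] : CharZero F := by
  obtain ⟨q, hq⟩ := CharP.exists F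
  rcases CharP.char_is_prime_or_zero F q with hq' | rfl
  · have h0 : (q : 𝒪[F]) = 0 := Subtype.ext (by simp)
    have h1 : (q : 𝓀[F]) = 0 := by
      rw [← map_natCast (IsLocalRing.residue 𝒪[F]), h0, map_zero]
    have h3 := (CharP.cast_eq_zero_iff 𝓀[F] 2 q).1 h1
    rw [Nat.prime_dvd_prime_iff_eq Nat.prime_two hq'] at h3
    subst h3
    exact absurd (by exact_mod_cast CharP.cast_eq_zero F 2) h2
  · exact CharP.charP_to_charZero F

theorem isOpen_integer : IsOpen (𝒪[F] : Set F) := by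
  refine AddSubgroup.isOpen_of_mem_nhds 𝒪[F].toAddSubgroup (g := 0) ?_
  exact (IsValuativeTopology.hasBasis_nhds_zero' F).mem_iff.2
    ⟨1, one_ne_zero, fun x (hx : valuation F x < 1) => hx.le⟩

/-- Every neighbourhood of zero contains a nonzero integer. -/
theorem exists_integer_mem_of_mem_nhds {U : Set F} (hU : U ∈ nhds 0) :
    ∃ a ∈ U, a ≠ 0 ∧ a ∈ 𝒪[F] := by
  obtain ⟨r, hr0, hr1⟩ := Valuation.IsNontrivial.exists_lt_one (v := valuation F)
  obtain ⟨n, hn⟩ := (isTopologicallyNilpotent_of_valuation_lt_one hr1).exists_pow_mem_of_mem_nhds hU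
  exact ⟨r ^ n, hn, pow_ne_zero n hr0, pow_mem (show r ∈ 𝒪[F] from hr1.le) n⟩

/-- The conductor of `ψ`: the fractional ideal of those `x` with `ψ(x 𝒪) = 1` is principal. It is
proper because `ψ` is non-trivial, and nonzero because `ψ` is smooth. -/
theorem exists_conductor {R : Type*} [Field R] {ψ : AddChar F Rˣ} (hψ : IsLocallyConstant ψ)
    (hψ1 : ψ ≠ 1) :
    ∃ c : F, c ≠ 0 ∧ ∀ x, (∀ y ∈ 𝒪[F], ψ (x * y) = 1) ↔ c⁻¹ * x ∈ 𝒪[F] := by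
  obtain ⟨x₀, hx₀⟩ : ∃ x₀, ψ x₀ ≠ 1 := by
    by_contra! h
    exact hψ1 (DFunLike.ext _ _ h)
  have hx₀0 : x₀ ≠ 0 := by
    rintro rfl
    exact hx₀ (AddChar.map_zero_eq_one ψ)
  let J : Ideal 𝒪[F] :=
    { carrier := {z | ∀ y ∈ 𝒪[F], ψ (x₀ * z * y) = 1}
      add_mem' := fun hz hz' y hy => by
        rw [Subring.coe_add, mul_add, add_mul, AddChar.map_add_eq_mul, hz y hy, hz' y hy, one_mul]
      zero_mem' := fun y _ => by simp
      smul_mem' := fun r z hz y hy => by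
        have := hz (r * y) (mul_mem r.2 hy)
        have h : x₀ * ((r * z : 𝒪[F]) : F) * y = x₀ * z * (r * y) := by
          rw [Subring.coe_mul]
          ring
        rwa [smul_eq_mul, h] }
  have hJ : ∀ z : 𝒪[F], z ∈ J ↔ ∀ y ∈ 𝒪[F], ψ (x₀ * z * y) = 1 := fun _ => Iff.rfl
  -- If `ψ(x 𝒪) = 1`, then `x` is an integral multiple of `x₀`, since `x₀` does not lie in `x 𝒪`.
  have hbound : ∀ x, (∀ y ∈ 𝒪[F], ψ (x * y) = 1) → x₀⁻¹ * x ∈ 𝒪[F] := by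
    intro x hx
    by_contra hcon
    have hlt : 1 < valuation F (x₀⁻¹ * x) := not_le.1 hcon
    refine hx₀ ?_
    have hx0 : x ≠ 0 := by
      rintro rfl
      exact hcon (by simp [zero_mem])
    have := hx (x⁻¹ * x₀) (by
      change valuation F _ ≤ 1
      have h : x⁻¹ * x₀ = (x₀⁻¹ * x)⁻¹ := by rw [mul_inv_rev, inv_inv]
      rw [h, map_inv₀]
      exact inv_le_one_of_one_le₀ hlt.le)
    rwa [mul_inv_cancel_left₀ hx0] at this
  obtain ⟨d, hd⟩ := (IsPrincipalIdealRing.principal J).principal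
  have hd' : ∀ z : 𝒪[F], z ∈ J ↔ d ∣ z := fun z => by
    rw [hd]
    exact Ideal.mem_span_singleton
  have hd0 : (d : F) ≠ 0 := by
    intro h0
    obtain ⟨γ, hγ, hγ'⟩ := (IsValuativeTopology.hasBasis_nhds_zero' F).mem_iff.1
      ((hψ.isOpen_fiber 1).mem_nhds (AddChar.map_zero_eq_one ψ))
    obtain ⟨a, haU, ha0, ha⟩ := exists_integer_mem_of_mem_nhds (F := F)
      (U := {a | valuation F (x₀ * a) < γ}) (by
        have hcont : Continuous fun a : F => x₀ * a := continuous_const_mul x₀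
        refine hcont.tendsto 0 (show {z | valuation F z < γ} ∈ nhds (x₀ * 0) from ?_)
        rw [mul_zero]
        exact (IsValuativeTopology.hasBasis_nhds_zero' F).mem_of_mem hγ)
    have : (⟨a, ha⟩ : 𝒪[F]) ∈ J := fun y hy => hγ' (by
      rw [Set.mem_ofPred_eq, map_mul]
      exact (mul_le_of_le_one_right' hy).trans_lt haU)
    rw [hd', show d = 0 from Subtype.ext h0, zero_dvd_iff] at this
    exact ha0 (congrArg Subtype.val this)
  refine ⟨x₀ * d, mul_ne_zero hx₀0 hd0, fun x => ⟨fun hx => ?_, fun hx => ?_⟩⟩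
  · obtain ⟨z, hz⟩ := (hd' ⟨x₀⁻¹ * x, hbound x hx⟩).1 ((hJ _).2 fun y hy => by
      rw [mul_inv_cancel_left₀ hx₀0]
      exact hx y hy)
    have hz' : x₀⁻¹ * x = d * z := congrArg Subtype.val hz
    have : (x₀ * (d : F))⁻¹ * x = z := by
      rw [mul_inv, mul_right_comm, hz', mul_right_comm, mul_inv_cancel₀ hd0, one_mul]
    rw [this]
    exact z.2
  · have h1 := (hJ _).1 ((hd' (d * ⟨_, hx⟩)).2 (dvd_mul_right _ _))
    have h2 : x₀ * ((d * (⟨(x₀ * d)⁻¹ * x, hx⟩ : 𝒪[F]) : 𝒪[F]) : F) = x := by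
      rw [Subring.coe_mul, ← mul_assoc, mul_inv_cancel_left₀ (mul_ne_zero hx₀0 hd0)]
    intro y hy
    have := h1 y hy
    rwa [h2] at this

variable {W : Type*} [AddCommGroup W] [Module F W] {ι : Type*}

theorem mem_span_integer_iff (b : Module.Basis ι F W) {w : W} :
    w ∈ Submodule.span 𝒪[F] (Set.range b) ↔ ∀ i, b.repr w i ∈ 𝒪[F] := by
  rw [Module.Basis.mem_span_iff_repr_mem]
  refine forall_congr' fun i => ⟨?_, fun h => ⟨⟨_, h⟩, rfl⟩⟩
  rintro ⟨z, hz⟩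
  rw [← hz]
  exact z.2

theorem isLatticeIn_span [Finite ι] (b : Module.Basis ι F W) :
    IsLatticeIn (Submodule.span 𝒪[F] (Set.range b)) := by
  have := Fintype.ofFinite ι
  refine ⟨Module.Free.of_basis (b.restrictScalars 𝒪[F]), ?_⟩
  rw [Module.finrank_eq_card_basis (b.restrictScalars 𝒪[F]), Module.finrank_eq_card_basis b]

variable {R : Type*} [Field R] {ψ : AddChar F Rˣ} {B : LinearMap.BilinForm F W}

/-- For a symplectic basis `e i`, `f i` and a generator `c` of the conductor of `ψ`, the lattice
spanned by the `e i` and the `c f i` is self-dual. -/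
theorem exists_isSelfDual_lattice [FiniteDimensional F W] (hψ : IsLocallyConstant ψ) (hψ1 : ψ ≠ 1)
    (hB : B.IsAlt) (hBnd : B.Nondegenerate) :
    ∃ (n : ℕ) (b : Module.Basis (Fin n ⊕ Fin n) F W),
      IsSelfDual ψ B (Submodule.span 𝒪[F] (Set.range b)).toAddSubgroup := by
  obtain ⟨c, hc0, hc⟩ := exists_conductor hψ hψ1
  obtain ⟨n, b, hb⟩ := exists_symplectic_basis hB hBnd
  let s : Fin n ⊕ Fin n → Fˣ := Sum.elim (fun _ => 1) (fun _ => Units.mk0 c hc0)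
  have hinl : ∀ w j, c⁻¹ * B w (b.unitsSMul s (Sum.inl j)) =
      -(b.unitsSMul s).repr w (Sum.inr j) := fun w j => by
    simp [s, Module.Basis.unitsSMul_apply, Module.Basis.repr_unitsSMul, hb.apply_inl hB,
      Units.smul_def]
  have hinr : ∀ w j, c⁻¹ * B w (b.unitsSMul s (Sum.inr j)) =
      (b.unitsSMul s).repr w (Sum.inl j) := fun w j => by
    simp [s, Module.Basis.unitsSMul_apply, Module.Basis.repr_unitsSMul, hb.apply_inr,
      Units.smul_def, hc0]
  have hiff : ∀ w, w ∈ Submodule.span 𝒪[F] (Set.range (b.unitsSMul s)) ↔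
      ∀ i, c⁻¹ * B w (b.unitsSMul s i) ∈ 𝒪[F] := by
    intro w
    rw [mem_span_integer_iff]
    constructor
    · rintro hw (j | j)
      · rw [hinl]
        exact neg_mem (hw _)
      · rw [hinr]
        exact hw _
    · rintro hw (j | j)
      · rw [← hinr]
        exact hw _
      · rw [← neg_mem_iff, ← hinl]
        exact hw _
  refine ⟨n, b.unitsSMul s, le_antisymm (fun w hw l hl => ?_) fun w hw => (hiff w).2 fun i => ?_⟩
  · have hw' := (hiff w).1 hw
    have hl' := (mem_span_integer_iff _).1 hl
    rw [← mul_one (B w l)]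
    refine (hc _).2 ?_ 1 (one_mem _)
    rw [← (b.unitsSMul s).sum_repr l, map_sum, Finset.mul_sum]
    refine sum_mem fun i _ => ?_
    rw [map_smul, smul_eq_mul, mul_left_comm]
    exact mul_mem (hl' i) (hw' i)
  · refine (hc _).1 fun y hy => ?_
    have := hw (y • b.unitsSMul s i)
      (Submodule.smul_mem _ (⟨y, hy⟩ : 𝒪[F]) (Submodule.subset_span ⟨i, rfl⟩))
    rwa [map_smul, smul_eq_mul, mul_comm] at this

section Topology

variable [TopologicalSpace W] [IsModuleTopology F W] [Finite ι]

theorem isOpen_span_integer (b : Module.Basis ι F W) :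
    IsOpen (Submodule.span 𝒪[F] (Set.range b) : Set W) := by
  have := Fintype.ofFinite ι
  have hc : Continuous b.equivFun := IsModuleTopology.continuous_of_linearMap b.equivFun.toLinearMap
  have : (Submodule.span 𝒪[F] (Set.range b) : Set W) =
      b.equivFun ⁻¹' Set.pi Set.univ fun _ => (𝒪[F] : Set F) := by
    ext w
    simp [mem_span_integer_iff]
  rw [this]
  exact (isOpen_set_pi Set.finite_univ fun _ _ => isOpen_integer).preimage hc

theorem isCompact_span_integer (b : Module.Basis ι F W) :
    IsCompact (Submodule.span 𝒪[F] (Set.range b) : Set W) := by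
  have : IsTopologicalAddGroup W := IsModuleTopology.topologicalAddGroup F W
  have := Fintype.ofFinite ι
  have hc : Continuous b.equivFun.symm :=
    IsModuleTopology.continuous_of_linearMap b.equivFun.symm.toLinearMap
  have : (Submodule.span 𝒪[F] (Set.range b) : Set W) =
      b.equivFun.symm '' Set.pi Set.univ fun _ => (𝒪[F] : Set F) := by
    rw [LinearEquiv.image_symm_eq_preimage]
    ext w
    simp [mem_span_integer_iff]
  rw [this]
  exact (isCompact_univ_pi fun _ => IsNonarchimedeanLocalField.isCompact_closedBall F 1).image hc

/-- A self-dual lattice `Λ` contains the arbitrarily small lattices `a Λ`, and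
`(a Λ)^⊥ = a⁻¹ Λ`. -/
theorem isGoodLattice_span (b : Module.Basis ι F W)
    (h : IsSelfDual ψ B (Submodule.span 𝒪[F] (Set.range b)).toAddSubgroup) :
    IsGoodLattice ψ B (Submodule.span 𝒪[F] (Set.range b)).toAddSubgroup := by
  have : IsTopologicalAddGroup W := IsModuleTopology.topologicalAddGroup F W
  set Λ := Submodule.span 𝒪[F] (Set.range b) with hΛ
  let D : F → AddSubgroup W := fun a => Λ.toAddSubgroup.comap (DistribSMul.toAddMonoidHom W a)
  have hD : ∀ a w, w ∈ D a ↔ a • w ∈ Λ := fun _ _ => Iff.rfl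
  have hDperp : ∀ a, a ≠ 0 → psiOrthogonal ψ B (D a⁻¹) = D a := by
    intro a ha
    ext w
    rw [hD]
    have hiff := h.mem_iff (w := a • w)
    rw [Submodule.mem_toAddSubgroup] at hiff
    rw [hiff]
    constructor
    · intro hw l hl
      have := hw (a • l) (by
        rw [hD, smul_smul, inv_mul_cancel₀ ha, one_smul]
        exact hl)
      rwa [map_smul, ← LinearMap.smul_apply, ← map_smul] at this
    · intro hw l hl
      have := hw (a⁻¹ • l) hl
      rwa [map_smul, ← LinearMap.smul_apply, ← map_smul, smul_smul, inv_mul_cancel₀ ha,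
        one_smul] at this
  have hDc : ∀ a, a ≠ 0 → IsCompact (D a : Set W) := by
    intro a ha
    have hc : Continuous fun w : W => a⁻¹ • w := continuous_const_smul a⁻¹
    have : (D a : Set W) = (fun w : W => a⁻¹ • w) '' (Λ : Set W) := by
      ext w
      constructor
      · exact fun hw => ⟨a • w, hw, by simp [smul_smul, inv_mul_cancel₀ ha]⟩
      · rintro ⟨l, hl, rfl⟩
        rw [SetLike.mem_coe, hD, smul_smul, mul_inv_cancel₀ ha, one_smul]
        exact hl
    rw [this]
    exact (isCompact_span_integer b).image hc
  refine ⟨h, isOpen_span_integer b, isCompact_span_integer b, fun U hU => ?_⟩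
  obtain ⟨N, _, hN, -, h0N, hΛN, hNU⟩ := generalized_tube_lemma (isCompact_singleton (x := (0 : F)))
    (isCompact_span_integer b)
    (n := (fun x : F × W => x.1 • x.2) ⁻¹' interior U)
    (isOpen_interior.preimage (by fun_prop)) (by
      rintro ⟨x, w⟩ ⟨rfl, -⟩
      simpa using mem_interior_iff_mem_nhds.2 hU)
  obtain ⟨a, haN, ha0, ha⟩ := exists_integer_mem_of_mem_nhds (hN.mem_nhds (h0N rfl))
  have hmem : ∀ w ∈ D a⁻¹, w = a • a⁻¹ • w := fun w _ => by
    rw [smul_smul, mul_inv_cancel₀ ha0, one_smul]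
  refine ⟨D a⁻¹, fun w hw => ?_, fun w hw => ?_, ?_, ?_, ?_⟩
  · rw [hmem w hw]
    exact Λ.smul_mem ⟨a, ha⟩ hw
  · rw [hmem w hw]
    exact interior_subset (hNU (Set.mk_mem_prod haN (hΛN hw)))
  · exact (isOpen_span_integer b).preimage (continuous_const_smul a⁻¹)
  · rw [hDperp a ha0]
    exact hDc a ha0
  · rw [hDperp a ha0]
    conv_lhs => rw [← inv_inv a]
    rw [hDperp a⁻¹ (inv_ne_zero ha0)]

end Topology

end Local

/-! ### Finite and local fields -/

section Classification

variable {F : Type*} [Field F] [TopologicalSpace F] {p : ℕ}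

theorem IsFiniteOrLocalField.prime (hF : IsFiniteOrLocalField F p) : p.Prime := by
  rcases hF with ⟨_, _, _⟩ | ⟨_, _, _⟩
  · exact CharP.char_is_prime F p
  · exact CharP.char_is_prime 𝓀[F] p

theorem IsFiniteOrLocalField.isTopologicallyNilpotent (hF : IsFiniteOrLocalField F p) :
    IsTopologicallyNilpotent (p : F) := by
  rcases hF with ⟨_, _, _⟩ | ⟨_, _, _⟩
  · rw [CharP.cast_eq_zero]
    exact IsTopologicallyNilpotent.zero
  · exact isTopologicallyNilpotent_of_valuation_lt_one (valuation_natCast_lt_one p)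

theorem IsFiniteOrLocalField.charZero_of_two (hF : IsFiniteOrLocalField F 2) (h2 : (2 : F) ≠ 0) :
    CharZero F := by
  rcases hF with ⟨_, _, _⟩ | ⟨_, _, _⟩
  · exact absurd (by exact_mod_cast CharP.cast_eq_zero F 2) h2
  · exact charZero_of_charP_residueField_two h2

variable {W : Type*} [AddCommGroup W] [Module F W] [FiniteDimensional F W]
  [TopologicalSpace W] [IsModuleTopology F W] {B : LinearMap.BilinForm F W}
  {R : Type*} [Field R] {ψ : AddChar F Rˣ}

theorem IsFiniteOrLocalField.exists_isGoodLattice (hF : IsFiniteOrLocalField F p)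
    (hψ : IsLocallyConstant ψ) (hψ1 : ψ ≠ 1) (hB : B.IsAlt) (hBnd : B.Nondegenerate) :
    ∃ Λ : AddSubgroup W, IsGoodLattice ψ B Λ := by
  rcases hF with ⟨_, _, _⟩ | ⟨_, _, _⟩
  · obtain ⟨X, hX⟩ := exists_isLagrangian hB hBnd
    exact ⟨_, hX.isGoodLattice hB hBnd hψ1⟩
  · obtain ⟨n, b, hb⟩ := exists_isSelfDual_lattice hψ hψ1 hB hBnd
    exact ⟨_, isGoodLattice_span b hb⟩

/-- For `p ≠ 2` the formula `(a, t) ↦ ψ(t)` works, because `ψ(⟨a, a'⟩ / 2)` is a square root of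
`1` of odd order. For `p = 2` the field has characteristic zero. -/
theorem IsFiniteOrLocalField.exists_isSmoothExtension [IsTopologicalRing F]
    (hF : IsFiniteOrLocalField F p)
    (h2 : (2 : F) ≠ 0) (hψ : IsLocallyConstant ψ) (hB : B.IsAlt) {Λ A : AddSubgroup W}
    (hΛ : IsGoodLattice ψ B Λ) (hA : IsSelfDual ψ B A) :
    ∃ χ : preimage B A →* Rˣ, IsSmoothExtension ψ B A χ := by
  by_cases hp2 : p = 2
  · subst hp2
    have := hF.charZero_of_two h2
    exact exists_extension_of_charZero hΛ hB h2 hψ hA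
  · obtain ⟨χ, hχ, -⟩ := exists_extension_of_psi_half_eq_one (B := B) (A := A) hψ
      fun a ha a' ha' => psi_half_eq_one_of_odd hF.prime hp2 h2 hF.isTopologicallyNilpotent hψ
        (hA.mem_iff.1 ha a' ha')
    exact ⟨χ, hχ⟩

end Classification

theorem theorem1p1
    {F : Type uF} [Field F] [TopologicalSpace F] [IsTopologicalRing F]
    (p : ℕ) (hF : IsFiniteOrLocalField F p) (h2 : (2 : F) ≠ 0)
    {W : Type uW} [AddCommGroup W] [Module F W] [FiniteDimensional F W]
    [TopologicalSpace W] [IsModuleTopology F W]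
    (B : LinearMap.BilinForm F W) (hBalt : B.IsAlt) (hBnd : B.Nondegenerate)
    {R : Type uR} [Field R] (ψ : AddChar F Rˣ) (hψ : IsLocallyConstant ψ) (hψ1 : ψ ≠ 1) :
    -- the characteristic of `R` is not `p`
    ringChar R ≠ p ∧
    -- existence
    (∃ (S : Type (max uF uW uR)) (_ : AddCommGroup S) (_ : Module R S)
      (ρ : Representation R (Heisenberg B) S), IsHeisenbergRep B ψ ρ) ∧
    -- uniqueness up to isomorphism
    (∀ (S₁ : Type v₁) [AddCommGroup S₁] [Module R S₁] (ρ₁ : Representation R (Heisenberg B) S₁)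
      (S₂ : Type v₂) [AddCommGroup S₂] [Module R S₂] (ρ₂ : Representation R (Heisenberg B) S₂),
      IsHeisenbergRep B ψ ρ₁ → IsHeisenbergRep B ψ ρ₂ →
        Nonempty (Representation.Equiv ρ₁ ρ₂)) ∧
    -- every self-dual subgroup affords models by compact induction
    (∀ A : AddSubgroup W, IsSelfDual ψ B A →
      (∃ χ : Heisenberg.preimage B A →* Rˣ, IsSmoothExtension ψ B A χ) ∧
      ∀ χ : Heisenberg.preimage B A →* Rˣ, IsSmoothExtension ψ B A χ →
        IsHeisenbergRep B ψ (compactInduction χ)) ∧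
    -- Lagrangians exist; each is self-dual, and `(x, t) ↦ ψ(t)` is then a smooth extension of `ψ`
    (∃ X : Submodule F W, IsLagrangian B X) ∧
    (∀ X : Submodule F W, IsLagrangian B X →
      IsSelfDual ψ B X.toAddSubgroup ∧
      ∃ χ : Heisenberg.preimage B X.toAddSubgroup →* Rˣ,
        IsSmoothExtension ψ B X.toAddSubgroup χ ∧ ∀ h, χ h = ψ (h : Heisenberg B).scalar) ∧
    -- self-dual lattices exist when `F` is local
    (∀ [ValuativeRel F] [IsNonarchimedeanLocalField F],
      ∃ L : Submodule 𝒪[F] W, IsLatticeIn L ∧ IsSelfDual ψ B L.toAddSubgroup) := by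
  have hp := hF.prime
  have hpF := hF.isTopologicallyNilpotent
  have hR : ringChar R ≠ p := ringChar_ne_of_isTopologicallyNilpotent hp hpF hψ hψ1
  obtain ⟨Λ, hΛ⟩ := hF.exists_isGoodLattice hψ hψ1 hBalt hBnd
  obtain ⟨χ, hχ⟩ := hF.exists_isSmoothExtension h2 hψ hBalt hΛ hΛ.selfDual
  have hind : ∀ A : AddSubgroup W, IsSelfDual ψ B A → ∀ χA : preimage B A →* Rˣ,
      IsSmoothExtension ψ B A χA → IsHeisenbergRep B ψ (compactInduction χA) := fun A hA χA hχA =>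
    isHeisenbergRep_compactInduction hΛ hBalt h2 hψ hp hpF hR hχ hA hχA
  refine ⟨hR, ⟨_, _, _, _, hind Λ hΛ.selfDual χ hχ⟩, ?_, fun A hA => ⟨?_, hind A hA⟩,
    exists_isLagrangian hBalt hBnd, fun X hX => ⟨hX.isSelfDual hBalt hBnd hψ1, ?_⟩, ?_⟩
  · intro S₁ _ _ ρ₁ S₂ _ _ ρ₂ h₁ h₂
    exact nonempty_equiv hΛ hBalt h2 hp hpF hR hχ h₁ h₂
  · exact hF.exists_isSmoothExtension h2 hψ hBalt hΛ hA
  · refine exists_extension_of_psi_half_eq_one hψ fun a ha a' ha' => ?_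
    rw [hX.1 a ha a' ha', zero_div, AddChar.map_zero_eq_one]
  · intro _ _
    obtain ⟨n, b, hb⟩ := exists_isSelfDual_lattice hψ hψ1 hBalt hBnd
    exact ⟨_, isLatticeIn_span b, hb⟩
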